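/- Let $V=\mathbb{R}\oplus\mathbb{C}^3=\mathbb{R}^7$ have the standard inner product and basis $e_1,\dots,e_7$, let $S^6\subset V$ be the unit sphere with its round metric $g_{can}$, and put $F_1=\frac{e_2-ie_3}{2}$, $F_2=\frac{e_4-ie_5}{2}$, $F_3=\frac{e_6-ie_7}{2}$, so that $e_1,F_1,F_2,F_3,\bar F_1,\bar F_2,\bar F_3$ is a basis of $V\otimes\mathbb{C}$. For $a\in\mathbb{C}^3$ let $[a]=\begin{pmatrix}0&a_3&-a_2\\-a_3&0&a_1\\a_2&-a_1&0\end{pmatrix}$. Let $\mathfrak{g}_2\subset\mathfrak{so}(V)$ be the Lie algebra of the endomorphisms whose matrix in this basis is $$\begin{pmatrix}0&-ia^*&ia^t\\-2ia&D&[\bar a]\\2i\bar a&[a]&\bar D\end{pmatrix},\qquad a\in\mathbb{C}^3,\ D\in\mathfrak{su}(3),$$ and let $G_2\subset SO(V)$ be the connected Lie subgroup with Lie algebra $\mathfrak{g}_2$. Let $x\colon G_2\to S^6$, $x(g)=g e_1$, be the orbit map, and let $\theta=(\theta^1,\theta^2,\theta^3)^t\in\Omega^1(G_2;\mathbb{C}^3)$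 be the component $a$ of the Maurer--Cartan form $\phi=g^{-1}dg\in\Omega^1(G_2;\mathfrak{g}_2)$. There is a unique almost complex structure $J_{can}$ on $S^6$ such that, for every $g\in G_2$, the complex covectors at $x(g)$ of type $(1,0)$ (respectively $(0,1)$) are exactly those whose pullbacks along $dx_g$ lie in the complex span of $\theta^1_g,\theta^2_g,\theta^3_g$ (respectively of $\bar\theta^1_g,\bar\theta^2_g,\bar\theta^3_g$). It is smooth and $g_{can}$-orthogonal. Put $\omega(u,v)=g_{can}(J_{can}u,v)$. Then $(S^6,J_{can},g_{can},\omega)$ is nearly Kähler, that is, $(\nabla_XJ_{can})X=0$ for every vector field $X$, where $\nabla$ is the Levi-Civita connection of $g_{can}$. Moreover $\omega$ is smooth, and there is a smooth complex $3$-form $\Upsilon$ on $S^6$ such that 1. $x^*g_{can}=4\,\theta^t\circ\bar\theta=4\sum_k\theta^k\circ\bar\theta^k$, where $\alpha\circ\beta=\frac12(\alpha\otimes\beta+\beta\otimes\alpha)$; 2. $x^*\omega=2i\,\theta^t\wedge\bar\theta=2i\sum_k\theta^k\wedge\bar\theta^k$, where $\alpha\wedge\beta=\alpha\otimes\beta-\beta\otimes\alpha$;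 3. $d\omega=-3\operatorname{Im}(\Upsilon)$; 4. $x^*\Upsilon=8\,\theta^1\wedge\theta^2\wedge\theta^3$ and $\Upsilon$ has $J_{can}$-type $(3,0)$. -/

import Mathlib

open scoped Manifold ContDiff

/-! ### Differential forms on a manifold

A differential `k`-form on a manifold `M` with values in `F` is a family of continuous alternating
maps `α p : T_p M [⋀^Fin k]→L[ℝ] F`. -/

namespace ManifoldForm

variable {E : Type*} [NormedAddCommGroup E] [NormedSpace ℝ E]
  {H : Type*} [TopologicalSpace H] (I : ModelWithCorners ℝ E H)
  {M : Type*} [TopologicalSpace M] [ChartedSpace H M]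
  {F : Type*} [NormedAddCommGroup F] [NormedSpace ℝ F] {k : ℕ}

/-- The local expression of a form in the preferred chart `φ` at `p`, that is `(φ⁻¹)^* α`. -/
noncomputable def localForm (α : ∀ q : M, TangentSpace I q [⋀^Fin k]→L[ℝ] F) (p : M) :
    E → E [⋀^Fin k]→L[ℝ] F := fun z =>
  (α ((extChartAt I p).symm z)).compContinuousLinearMap
    (mfderiv 𝓘(ℝ, E) I (extChartAt I p).symm z)

/-- A form is smooth if all its local expressions are (for manifolds without boundary). -/
def IsSmooth (α : ∀ q : M, TangentSpace I q [⋀^Fin k]→L[ℝ] F) : Prop :=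
  ∀ p : M, ContDiffOn ℝ ∞ (localForm I α p) (extChartAt I p).target

/-- The exterior derivative of a form on a manifold without boundary, computed in charts:
`(dα)_p = φ^* d((φ⁻¹)^* α)` at `p`, with `φ` the preferred chart at `p`. The normalization is
`d(f dx₁ ∧ ⋯) = df ∧ dx₁ ∧ ⋯` with the determinant convention for wedge products. -/
noncomputable def d (α : ∀ q : M, TangentSpace I q [⋀^Fin k]→L[ℝ] F) (p : M) :
    TangentSpace I p [⋀^Fin (k + 1)]→L[ℝ] F :=
  (extDeriv (localForm I α p) (extChartAt I p p)).compContinuousLinearMap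
    (mfderiv I 𝓘(ℝ, E) (extChartAt I p) p)

end ManifoldForm

namespace SixSphere

/-- The Euclidean space `V = ℝ ⊕ ℂ³ = ℝ⁷`; its standard basis `e₁, …, e₇` has indices
`0, …, 6`. -/
abbrev V : Type := EuclideanSpace ℝ (Fin 7)

/-- The unit sphere `S⁶` in `V`. -/
abbrev S6 : Type := Metric.sphere (0 : V) 1

/-- The tangent space `T_p S⁶`. -/
abbrev T (p : S6) : Type := TangentSpace (𝓡 6) p

/-- The differential at `p` of the inclusion `S⁶ → V`. -/
noncomputable def dincl (p : S6) : T p →L[ℝ] V :=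
  mvfderiv (𝓡 6) (Subtype.val : S6 → V) p

/-- The round metric on `S⁶`. -/
noncomputable def gcan (p : S6) (u v : T p) : ℝ := inner ℝ (dincl p u) (dincl p v)

/-! ### Almost complex structures on `S⁶` and types of forms -/

/-- A complex-valued covector `α ∈ T_p^* S⁶ ⊗ ℂ` has `J`-type `(1,0)`. -/
def IsType10 (J : ∀ p : S6, T p →L[ℝ] T p) (p : S6) (α : T p →L[ℝ] ℂ) : Prop :=
  ∀ v, α (J p v) = Complex.I * α v

/-- A complex-valued covector `α ∈ T_p^* S⁶ ⊗ ℂ` has `J`-type `(0,1)`. -/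
def IsType01 (J : ∀ p : S6, T p →L[ℝ] T p) (p : S6) (α : T p →L[ℝ] ℂ) : Prop :=
  ∀ v, α (J p v) = -Complex.I * α v

/-- A complex `3`-form has `J`-type `(3,0)`: at every point it is a complex linear combination of
wedge products `α₁ ∧ α₂ ∧ α₃` of covectors of type `(1,0)`. -/
def IsType30 (J : ∀ p : S6, T p →L[ℝ] T p) (Υ : ∀ p : S6, T p [⋀^Fin 3]→L[ℝ] ℂ) : Prop :=
  ∀ p, (fun v => Υ p v) ∈ Submodule.span ℂ
    {w : (Fin 3 → T p) → ℂ | ∃ α : Fin 3 → (T p →L[ℝ] ℂ), (∀ i, IsType10 J p (α i)) ∧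
      w = fun v => Matrix.det (Matrix.of fun i j => α i (v j))}

/-- An almost Hermitian structure `(J, g_can)` on `S⁶`: a smooth almost complex structure which is
orthogonal for the round metric. -/
structure AlmostHermitian where
  /-- the almost complex structure -/
  J : ∀ p : S6, T p →L[ℝ] T p
  smooth_J : ContMDiff (𝓡 6)
    ((𝓡 6).prod 𝓘(ℝ, EuclideanSpace ℝ (Fin 6) →L[ℝ] EuclideanSpace ℝ (Fin 6))) ∞
    (fun p => Bundle.TotalSpace.mk' (EuclideanSpace ℝ (Fin 6) →L[ℝ] EuclideanSpace ℝ (Fin 6))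
      (E := fun p : S6 => T p →L[ℝ] T p) p (J p))
  J_sq : ∀ p v, J p (J p v) = -v
  J_orth : ∀ p u v, gcan p (J p u) (J p v) = gcan p u v

theorem gcan_comm (p : S6) (u v : T p) : gcan p u v = gcan p v u :=
  real_inner_comm _ _

theorem AlmostHermitian.gcan_J_self (h : AlmostHermitian) (p : S6) (v : T p) :
    gcan p (h.J p v) v = 0 := by
  have h1 := h.J_orth p (h.J p v) v
  rw [h.J_sq, gcan_comm p (h.J p v) v] at h1
  have h2 : gcan p (-v) (h.J p v) = -gcan p v (h.J p v) := by
    simp [gcan, inner_neg_left]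
  rw [gcan_comm]
  linarith

/-- The fundamental `2`-form `ω(u, v) = g_can(J u, v)`. -/
noncomputable def AlmostHermitian.omega (h : AlmostHermitian) (p : S6) :
    T p [⋀^Fin 2]→L[ℝ] ℝ where
  toFun v := gcan p (h.J p (v 0)) (v 1)
  map_update_add' m i x y := by
    fin_cases i <;> simp [gcan, inner_add_left, inner_add_right]
  map_update_smul' m i c x := by
    fin_cases i <;> simp [gcan, inner_smul_left, inner_smul_right]
  map_eq_zero_of_eq' v i j hv hij := by
    have h01 : v 0 = v 1 := by
      fin_cases i <;> fin_cases j <;> simp_all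
    show gcan p (h.J p (v 0)) (v 1) = 0
    rw [h01]
    exact h.gcan_J_self p (v 1)
  cont := by
    show Continuous fun v : Fin 2 → T p => gcan p (h.J p (v 0)) (v 1)
    unfold gcan
    fun_prop

/-- The vector field `X` on `S⁶` is differentiable at `p`, as a section of the tangent bundle. -/
def IsDiffAt (X : ∀ q : S6, TangentSpace (𝓡 6) q) (p : S6) : Prop :=
  MDifferentiableAt (𝓡 6) ((𝓡 6).prod 𝓘(ℝ, EuclideanSpace ℝ (Fin 6)))
    (fun q => Bundle.TotalSpace.mk' (EuclideanSpace ℝ (Fin 6))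
      (E := (TangentSpace (𝓡 6) : S6 → Type _)) q (X q)) p

/-- A connection on `T S⁶` is the Levi-Civita connection of `g_can`: it is torsion free and
compatible with the metric. (`cov σ p v` is `(∇_v σ)(p)`.) -/
def IsLeviCivita (cov : CovariantDerivative (𝓡 6) (EuclideanSpace ℝ (Fin 6))
    (TangentSpace (𝓡 6) : S6 → Type _)) : Prop :=
  cov.torsion = 0 ∧
  ∀ (p : S6) (σ τ : ∀ q : S6, TangentSpace (𝓡 6) q),
    IsDiffAt σ p → IsDiffAt τ p → ∀ v : T p,
      mvfderiv (𝓡 6) (fun q => gcan q (σ q) (τ q)) p v =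
        gcan p (cov σ p v) (τ p) + gcan p (σ p) (cov τ p v)

/-- `(S⁶, J, g_can, ω)` is nearly Kähler: `(∇_X J) X = ∇_X (J X) - J (∇_X X) = 0` for every vector
field `X`, with `∇` the Levi-Civita connection of `g_can`. -/
def AlmostHermitian.IsNearlyKahler (h : AlmostHermitian) : Prop :=
  ∃ cov : CovariantDerivative (𝓡 6) (EuclideanSpace ℝ (Fin 6))
      (TangentSpace (𝓡 6) : S6 → Type _),
    IsLeviCivita cov ∧
    ∀ (p : S6) (X : ∀ q : S6, TangentSpace (𝓡 6) q), IsDiffAt X p →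
      cov (fun q => h.J q (X q)) p (X p) - h.J p (cov X p (X p)) = 0

/-! ### The group `G₂` and its Maurer–Cartan form -/

/-- The matrix whose columns are the basis `e₁, F₁, F₂, F₃, F̄₁, F̄₂, F̄₃` of `V ⊗ ℂ`, where
`F₁ = (e₂ - i e₃)/2`, `F₂ = (e₄ - i e₅)/2`, `F₃ = (e₆ - i e₇)/2`. -/
noncomputable def frame : Matrix (Fin 7) (Fin 7) ℂ :=
  !![1, 0, 0, 0, 0, 0, 0;
     0, 1 / 2, 0, 0, 1 / 2, 0, 0;
     0, -Complex.I / 2, 0, 0, Complex.I / 2, 0, 0;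
     0, 0, 1 / 2, 0, 0, 1 / 2, 0;
     0, 0, -Complex.I / 2, 0, 0, Complex.I / 2, 0;
     0, 0, 0, 1 / 2, 0, 0, 1 / 2;
     0, 0, 0, -Complex.I / 2, 0, 0, Complex.I / 2]

/-- The matrix of a real endomorphism of `V` in the basis `e₁, F₁, F₂, F₃, F̄₁, F̄₂, F̄₃`. -/
noncomputable def inFrame (A : Matrix (Fin 7) (Fin 7) ℝ) : Matrix (Fin 7) (Fin 7) ℂ :=
  frame⁻¹ * A.map Complex.ofReal * frame

open ComplexConjugate in
/-- The block matrix with rows `(0, -i a^*, i a^t)`, `(-2 i a, D, [ā])`, `(2 i ā, [a], D̄)`, where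
`[a]` has rows `(0, a₃, -a₂)`, `(-a₃, 0, a₁)`, `(a₂, -a₁, 0)`. -/
noncomputable def g2Matrix (a : Fin 3 → ℂ) (D : Matrix (Fin 3) (Fin 3) ℂ) :
    Matrix (Fin 7) (Fin 7) ℂ :=
  let i := Complex.I
  !![0, -i * conj (a 0), -i * conj (a 1), -i * conj (a 2), i * a 0, i * a 1, i * a 2;
     -2 * i * a 0, D 0 0, D 0 1, D 0 2, 0, conj (a 2), -conj (a 1);
     -2 * i * a 1, D 1 0, D 1 1, D 1 2, -conj (a 2), 0, conj (a 0);
     -2 * i * a 2, D 2 0, D 2 1, D 2 2, conj (a 1), -conj (a 0), 0;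
     2 * i * conj (a 0), 0, a 2, -a 1, conj (D 0 0), conj (D 0 1), conj (D 0 2);
     2 * i * conj (a 1), -a 2, 0, a 0, conj (D 1 0), conj (D 1 1), conj (D 1 2);
     2 * i * conj (a 2), a 1, -a 0, 0, conj (D 2 0), conj (D 2 1), conj (D 2 2)]

/-- The Lie algebra `𝔤₂`, as a set of endomorphisms of `V`: those whose matrix in the basis
`e₁, F₁, F₂, F₃, F̄₁, F̄₂, F̄₃` is `g2Matrix a D` with `a ∈ ℂ³`, `D ∈ 𝔰𝔲(3)`. -/
def g2 : Set (Matrix (Fin 7) (Fin 7) ℝ) :=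
  {A | ∃ (a : Fin 3 → ℂ) (D : Matrix (Fin 3) (Fin 3) ℂ),
    D.conjTranspose = -D ∧ D.trace = 0 ∧ inFrame A = g2Matrix a D}

/-- The group `G₂`: the connected Lie group of isometries of `V` with Lie algebra `𝔤₂`, that is the
subgroup generated by the matrix exponentials of elements of `𝔤₂`. -/
def G2 : Subgroup (Matrix.orthogonalGroup (Fin 7) ℝ) :=
  Subgroup.closure {u | ∃ A ∈ g2, (u : Matrix (Fin 7) (Fin 7) ℝ) = NormedSpace.exp A}

/-- The underlying matrix `ρ_g` of an element `g` of `G₂`. -/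
def mat (g : G2) : Matrix (Fin 7) (Fin 7) ℝ := g.1.1

/-- The orbit map `x : G₂ → S⁶`, `x(g) = ρ_g(e₁)`, the first column of `ρ_g`. -/
noncomputable def orbit (g : G2) : S6 :=
  ⟨WithLp.toLp 2 fun i => mat g i 0, by
    have h : (mat g).transpose * mat g = 1 := by
      have := Matrix.mem_unitaryGroup_iff'.1 g.1.2
      rwa [Matrix.star_eq_conjTranspose, Matrix.conjTranspose_eq_transpose_of_trivial] at this
    have h0 := congrFun (congrFun h 0) 0
    simp only [Matrix.mul_apply, Matrix.transpose_apply, Matrix.one_apply_eq] at h0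
    rw [mem_sphere_zero_iff_norm, EuclideanSpace.norm_eq, Real.sqrt_eq_one]
    simpa [sq] using h0⟩

/-- A tangent vector `X ∈ T_g G₂`, represented by a smooth curve in `G₂` through `g`. Smoothness is
tested on matrix entries, since `G₂` is an embedded submanifold of the space of matrices. -/
structure Tangent (g : G2) where
  /-- the curve -/
  curve : ℝ → G2
  base : curve 0 = g
  smooth : ∀ i j, ContDiff ℝ ∞ fun t => mat (curve t) i j

variable {g : G2}

/-- The matrix `X = γ'(0)` of a tangent vector. -/
noncomputable def Tangent.velocity (X : Tangent g) : Matrix (Fin 7) (Fin 7) ℝ :=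
  Matrix.of fun i j => deriv (fun t => mat (X.curve t) i j) 0

/-- The Maurer–Cartan form `φ(X) = g⁻¹ X`, as a matrix in the basis `e₁, F_k, F̄_k`. -/
noncomputable def maurerCartan (X : Tangent g) : Matrix (Fin 7) (Fin 7) ℂ :=
  inFrame ((mat g)⁻¹ * X.velocity)

/-- The components `θ¹, θ², θ³` of the Maurer–Cartan form: by the definition of `g2Matrix`, the
first column of `φ` is `(0, -2 i θ, 2 i θ̄)`. -/
noncomputable def theta (k : Fin 3) (X : Tangent g) : ℂ :=
  Complex.I / 2 * maurerCartan X (![1, 2, 3] k) 0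

/-- The differential `dx_g(X) ∈ T_{x(g)} S⁶` of the orbit map: the velocity of the image curve. -/
noncomputable def dorbit (X : Tangent g) : T (orbit g) :=
  X.base ▸ (mfderiv 𝓘(ℝ, ℝ) (𝓡 6) (fun t => orbit (X.curve t)) 0 (1 : ℝ) : T (orbit (X.curve 0)))

open ComplexConjugate in
/-- `J` is the octonionic almost complex structure `J_can`: for every `y ∈ S⁶` and every `g ∈ G₂`
with `x(g) = y`, the `(1,0)`-covectors at `y` are the combinations of `θ¹, θ², θ³` (descended along
`dx_g`), and the `(0,1)`-covectors are the combinations of their conjugates. -/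
def IsOctonionic (J : ∀ p : S6, T p →L[ℝ] T p) : Prop :=
  ∀ (g : G2) (α : T (orbit g) →L[ℝ] ℂ),
    (IsType10 J (orbit g) α ↔
      ∃ c : Fin 3 → ℂ, ∀ X : Tangent g, α (dorbit X) = ∑ k, c k * theta k X) ∧
    (IsType01 J (orbit g) α ↔
      ∃ c : Fin 3 → ℂ, ∀ X : Tangent g, α (dorbit X) = ∑ k, c k * conj (theta k X))

end SixSphere

open SixSphere

/-! Everything comes from the octonionic cross product on `V`. Each element of 𝔤₂ is a derivation of
it (`g2_derivation`), hence its exponential is an automorphism (`bilinear_exp`), and so all of `G2`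
preserves both the product and the inner product (`cross_act`, `inner_act_act`). Put J_p v = p × v.
The identity u × (u × v) = ⟨u,v⟩u − ⟨u,u⟩v gives J² = −1 on p^⊥, and J is G₂-equivariant.

At e₁ the map J is multiplication by i on e₁^⊥ = ℂ³. The first column of g⁻¹X is g⁻¹(dx(X)), so θ^k
is i/2 times the k-th complex coordinate of g⁻¹(dx(X)) and descends along dx (`theta_eq`). As `G2`
acts transitively (`exists_orbit_eq`) and dx_g is onto (`exists_dorbit_eq`), the θ^k span the
(1,0)-covectors everywhere. They separate tangent vectors, which makes J unique. By equivariance the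
formulas for the metric, ω and Υ only need to be checked at e₁, where they are polynomial
identities.

The Levi-Civita connection is the tangential part of the flat derivative. Differentiating p × X in
the direction X gives X × X + p × D_X X; the first term vanishes, and the second is J(∇_X X): this
is the nearly Kähler identity (`leviCivita_octJ`).

The form ω is the restriction of ⟨x × u, v⟩, which is linear in x, so its ambient exterior
derivative is three times the associative form φ(u,v,w) = ⟨u × v, w⟩. The form Υ is the restriction
of χ_x − iφ, where on x^⊥ one has χ_x(u,v,w) = −φ(x × u, v, w), as complex linearity in u forces.
Restriction commutes with d (`d_restrictForm`), which yields dω = 3φ = −3 Im Υ. -/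

namespace SixSphere

/-! ### The octonionic cross product -/

/-- The coordinates of the octonionic cross product on `V`. -/
noncomputable def crossFun (u v : V) : V :=
  !₂[(u 1 * v 2 - u 2 * v 1) + (u 3 * v 4 - u 4 * v 3) + (u 5 * v 6 - u 6 * v 5),
    -(u 0 * v 2 - u 2 * v 0) + (u 3 * v 5 - u 5 * v 3) - (u 4 * v 6 - u 6 * v 4),
    (u 0 * v 1 - u 1 * v 0) - (u 3 * v 6 - u 6 * v 3) - (u 4 * v 5 - u 5 * v 4),
    -(u 0 * v 4 - u 4 * v 0) - (u 1 * v 5 - u 5 * v 1) + (u 2 * v 6 - u 6 * v 2),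
    (u 0 * v 3 - u 3 * v 0) + (u 1 * v 6 - u 6 * v 1) + (u 2 * v 5 - u 5 * v 2),
    -(u 0 * v 6 - u 6 * v 0) + (u 1 * v 3 - u 3 * v 1) - (u 2 * v 4 - u 4 * v 2),
    (u 0 * v 5 - u 5 * v 0) - (u 1 * v 4 - u 4 * v 1) - (u 2 * v 3 - u 3 * v 2)]

/-- The octonionic cross product as a bilinear map. -/
noncomputable def crossBilin : V →ₗ[ℝ] V →ₗ[ℝ] V :=
  LinearMap.mk₂ ℝ crossFun
    (fun u u' v => by ext i; fin_cases i <;> simp [crossFun] <;> ring)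
    (fun c u v => by ext i; fin_cases i <;> simp [crossFun] <;> ring)
    (fun u v v' => by ext i; fin_cases i <;> simp [crossFun] <;> ring)
    (fun c u v => by ext i; fin_cases i <;> simp [crossFun] <;> ring)

/-- The octonionic cross product as a continuous bilinear map. -/
noncomputable def cross : V →L[ℝ] V →L[ℝ] V :=
  LinearMap.toContinuousLinearMap
    (LinearMap.toContinuousLinearMap.toLinearMap ∘ₗ crossBilin)

theorem cross_apply (u v : V) : cross u v = crossFun u v := rfl

theorem inner_eq (u v : V) : inner ℝ u v =
    u 0 * v 0 + u 1 * v 1 + u 2 * v 2 + u 3 * v 3 + u 4 * v 4 + u 5 * v 5 + u 6 * v 6 := by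
  simp only [PiLp.inner_apply, RCLike.inner_apply, conj_trivial, Fin.sum_univ_succ, Fin.sum_univ_zero,
    Fin.isValue]
  simp
  ring

theorem cross_self (u : V) : cross u u = 0 := by
  ext i; fin_cases i <;> simp [cross_apply, crossFun] <;> ring

theorem cross_swap (u v : V) : cross v u = -cross u v := by
  ext i; fin_cases i <;> simp [cross_apply, crossFun] <;> ring

theorem inner_cross_left (u v : V) : inner ℝ u (cross u v) = 0 := by
  simp only [inner_eq]; simp [cross_apply, crossFun]; ring

theorem inner_cross_right (u v : V) : inner ℝ v (cross u v) = 0 := by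
  simp only [inner_eq]; simp [cross_apply, crossFun]; ring

/-- For a unit vector u this says that u × · squares to −1 on u^⊥, the source of J² = −1. -/
theorem cross_cross (u v : V) : cross u (cross u v) = inner ℝ u v • u - inner ℝ u u • v := by
  simp only [inner_eq]; ext i; fin_cases i <;> simp [cross_apply, crossFun] <;> ring

theorem inner_cross_cyclic (u v w : V) : inner ℝ (cross u v) w = inner ℝ (cross v w) u := by
  simp only [inner_eq]; simp [cross_apply, crossFun]; ring

theorem inner_cross_cross (p u v : V) : inner ℝ (cross p u) (cross p v) =
    inner ℝ p p * inner ℝ u v - inner ℝ p u * inner ℝ p v := by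
  simp only [inner_eq]; simp [cross_apply, crossFun]; ring

/-- The quartic expression that restricts to the real part of the `(3,0)`-form on `x^⊥`. -/
noncomputable def chiFun (x u v w : V) : ℝ :=
  inner ℝ x v * inner ℝ u w - inner ℝ x w * inner ℝ u v - inner ℝ (cross x u) (cross v w)

/-- The two inner product terms in `chiFun` vanish for u, v, w orthogonal to x; they are there so
that antisymmetry holds on all of V and the ambient form exists. -/
theorem chiFun_swap₁₂ (x u v w : V) : chiFun x v u w = -chiFun x u v w := by
  simp only [chiFun, inner_eq]; simp [cross_apply, crossFun]; ring

theorem chiFun_swap₂₃ (x u v w : V) : chiFun x u w v = -chiFun x u v w := by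
  simp only [chiFun, inner_eq]; simp [cross_apply, crossFun]; ring

/-! ### Ambient differential forms -/

/-- The alternating form `(u, v) ↦ ⟨x × u, v⟩`. -/
noncomputable def ambientOmegaFun (x : V) : V [⋀^Fin 2]→L[ℝ] ℝ where
  toFun v := inner ℝ (cross x (v 0)) (v 1)
  map_update_add' m i x y := by fin_cases i <;> simp [inner_add_left, inner_add_right]
  map_update_smul' m i c x := by fin_cases i <;> simp [inner_smul_left, inner_smul_right]
  map_eq_zero_of_eq' v i j hv hij := by
    have h01 : v 0 = v 1 := by fin_cases i <;> fin_cases j <;> simp_all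
    rw [h01, real_inner_comm, inner_cross_right]
  cont := by fun_prop

theorem ambientOmegaFun_apply (x : V) (v : Fin 2 → V) :
    ambientOmegaFun x v = inner ℝ (cross x (v 0)) (v 1) := rfl

/-- The `2`-form `x ↦ ⟨x × ·, ·⟩` on `V`. -/
noncomputable def ambientOmega : V →L[ℝ] V [⋀^Fin 2]→L[ℝ] ℝ :=
  LinearMap.toContinuousLinearMap
    { toFun := ambientOmegaFun
      map_add' := fun x y => by ext v; simp [ambientOmegaFun_apply, inner_add_left]
      map_smul' := fun c x => by ext v; simp [ambientOmegaFun_apply, inner_smul_left] }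

/-- The associative `3`-form `⟨u × v, w⟩` on `V`. -/
noncomputable def assocForm : V [⋀^Fin 3]→L[ℝ] ℝ where
  toFun v := inner ℝ (cross (v 0) (v 1)) (v 2)
  map_update_add' m i x y := by
    -- The field quantifies over an arbitrary `DecidableEq` instance; with the canonical one `simp`
    -- can evaluate the updates.
    rename_i inst
    obtain rfl := Subsingleton.elim inst (instDecidableEqFin 3)
    fin_cases i <;> simp [inner_add_left, inner_add_right]
  map_update_smul' m i c x := by
    rename_i inst
    obtain rfl := Subsingleton.elim inst (instDecidableEqFin 3)
    fin_cases i <;> simp [inner_smul_left, inner_smul_right]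
  map_eq_zero_of_eq' v i j hv hij := by
    have h : v 0 = v 1 ∨ v 1 = v 2 ∨ v 0 = v 2 := by
      fin_cases i <;> fin_cases j <;> simp_all
    rcases h with h | h | h
    · simp [h, cross_self]
    · rw [h, real_inner_comm, inner_cross_right]
    · rw [h, real_inner_comm, inner_cross_left]
  cont := by fun_prop

theorem assocForm_apply (v : Fin 3 → V) :
    assocForm v = inner ℝ (cross (v 0) (v 1)) (v 2) := rfl

/-- The alternating form `chiFun x`. -/
noncomputable def ambientChiFun (x : V) : V [⋀^Fin 3]→L[ℝ] ℝ where
  toFun v := chiFun x (v 0) (v 1) (v 2)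
  map_update_add' m i y z := by
    rename_i inst
    obtain rfl := Subsingleton.elim inst (instDecidableEqFin 3)
    fin_cases i <;> simp [chiFun, inner_add_left, inner_add_right] <;> ring
  map_update_smul' m i c y := by
    rename_i inst
    obtain rfl := Subsingleton.elim inst (instDecidableEqFin 3)
    fin_cases i <;> simp [chiFun, inner_smul_left, inner_smul_right] <;> ring
  map_eq_zero_of_eq' v i j hv hij := by
    have h : v 0 = v 1 ∨ v 1 = v 2 ∨ v 0 = v 2 := by
      fin_cases i <;> fin_cases j <;> simp_all
    have h₁ := chiFun_swap₁₂ x (v 0) (v 1) (v 2)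
    have h₂ := chiFun_swap₂₃ x (v 0) (v 1) (v 2)
    have h₃ := chiFun_swap₂₃ x (v 1) (v 0) (v 2)
    have h₄ := chiFun_swap₁₂ x (v 1) (v 2) (v 0)
    rcases h with h | h | h
    · rw [h] at h₁ ⊢; linarith
    · rw [h] at h₂ ⊢; linarith
    · rw [h] at h₁ h₃ h₄ ⊢; linarith
  cont := by unfold chiFun; fun_prop

theorem ambientChiFun_apply (x : V) (v : Fin 3 → V) :
    ambientChiFun x v = chiFun x (v 0) (v 1) (v 2) := rfl

/-- The `3`-form `x ↦ chiFun x` on `V`. -/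
noncomputable def ambientChi : V →L[ℝ] V [⋀^Fin 3]→L[ℝ] ℝ :=
  LinearMap.toContinuousLinearMap
    { toFun := ambientChiFun
      map_add' := fun x y => by
        ext v; simp [ambientChiFun_apply, chiFun, inner_add_left]; ring
      map_smul' := fun c x => by
        ext v; simp [ambientChiFun_apply, chiFun, inner_smul_left]; ring }

theorem ambientChi_apply (x : V) (v : Fin 3 → V) :
    ambientChi x v = chiFun x (v 0) (v 1) (v 2) := rfl

/-- The complex `3`-form on `V` with real part `ambientChi` and imaginary part `-assocForm`. -/
noncomputable def ambientUpsilon (x : V) : V [⋀^Fin 3]→L[ℝ] ℂ :=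
  Complex.ofRealCLM.compContinuousAlternatingMap (ambientChi x) -
    (Complex.I • Complex.ofRealCLM).compContinuousAlternatingMap assocForm

theorem ambientUpsilon_apply (x : V) (v : Fin 3 → V) : ambientUpsilon x v =
    (chiFun x (v 0) (v 1) (v 2) : ℂ) - Complex.I * (inner ℝ (cross (v 0) (v 1)) (v 2) : ℝ) := by
  simp [ambientUpsilon, ambientChi_apply, assocForm_apply]

theorem contDiff_ambientUpsilon : ContDiff ℝ ∞ ambientUpsilon := by
  unfold ambientUpsilon
  exact (((ContinuousLinearMap.compContinuousAlternatingMapCLM ℝ V ℝ ℂ (Fin 3)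
    Complex.ofRealCLM).comp ambientChi).contDiff).sub contDiff_const

/-- Linearity in x makes the derivative constant, equal to the form itself; by cyclicity and
antisymmetry its three alternation terms coincide, whence the factor 3. -/
theorem extDeriv_ambientOmega (x : V) :
    extDeriv (fun y => ambientOmega y) x = (3 : ℝ) • assocForm := by
  ext v
  have h : fderiv ℝ (fun y => ambientOmega y) x = ambientOmega := ambientOmega.fderiv
  have h₁ := inner_cross_cyclic (v 0) (v 1) (v 2)
  have h₂ : inner ℝ (cross (v 1) (v 0)) (v 2) = -inner ℝ (cross (v 0) (v 1)) (v 2) := by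
    rw [cross_swap (v 0) (v 1), inner_neg_left]
  have h₃ := inner_cross_cyclic (v 2) (v 0) (v 1)
  rw [extDeriv, h, ContinuousAlternatingMap.alternatizeUncurryFin_apply]
  have e₀ : ambientOmega (v 0) ((0 : Fin 3).removeNth v) = inner ℝ (cross (v 0) (v 1)) (v 2) := rfl
  have e₁ : ambientOmega (v 1) ((1 : Fin 3).removeNth v) = inner ℝ (cross (v 1) (v 0)) (v 2) := rfl
  have e₂ : ambientOmega (v 2) ((2 : Fin 3).removeNth v) = inner ℝ (cross (v 2) (v 0)) (v 1) := rfl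
  have s : ((3 : ℝ) • assocForm) v = 3 * inner ℝ (cross (v 0) (v 1)) (v 2) := rfl
  rw [Fin.sum_univ_three, e₀, e₁, e₂, s]
  simp [h₂, h₃]
  ring

end SixSphere

namespace SixSphere

/-! ### Derivations of the cross product -/

section Exp

variable {E : Type*} [NormedAddCommGroup E] [NormedSpace ℝ E] [CompleteSpace E] {D : E →L[ℝ] E}

theorem hasDerivAt_exp_neg_smul_apply (D : E →L[ℝ] E) {f : ℝ → E} {f' : E} {t : ℝ}
    (hf : HasDerivAt f f' t) :
    HasDerivAt (fun s => NormedSpace.exp ((-s) • D) (f s))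
      (NormedSpace.exp ((-t) • D) (f' - D (f t))) t := by
  have h := ((hasDerivAt_exp_smul_const (𝕂 := ℝ) D (-t)).scomp t (hasDerivAt_neg t)).clm_apply hf
  have e : NormedSpace.exp ((-t) • D) (f' - D (f t)) =
      (-1 : ℝ) • NormedSpace.exp ((-t) • D) (D (f t)) + NormedSpace.exp ((-t) • D) f' := by
    rw [map_sub]
    module
  rw [e]
  exact h

/-- Uniqueness for the linear equation f' = D f: the integrating factor exp(−tD) turns f into a
constant. -/
theorem eq_exp_apply_of_hasDerivAt (D : E →L[ℝ] E) {f : ℝ → E}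
    (hf : ∀ t, HasDerivAt f (D (f t)) t) (t : ℝ) :
    f t = NormedSpace.exp (t • D) (f 0) := by
  have h : ∀ s, HasDerivAt (fun s => NormedSpace.exp ((-s) • D) (f s)) 0 s := fun s => by
    simpa using hasDerivAt_exp_neg_smul_apply D (hf s)
  have h₀ := is_const_of_deriv_eq_zero (fun s => (h s).differentiableAt) (fun s => (h s).deriv) t 0
  simp only [neg_zero, zero_smul, NormedSpace.exp_zero, one_apply_eq_self] at h₀
  rw [← h₀, ← mul_apply_eq_comp]
  let _ : NormedAlgebra ℚ (E →L[ℝ] E) := NormedAlgebra.restrictScalars ℚ ℝ _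
  rw [← NormedSpace.exp_add_of_commute ((Commute.refl D).smul_left _ |>.smul_right _)]
  simp

theorem hasDerivAt_exp_smul_apply (D : E →L[ℝ] E) (u : E) (t : ℝ) :
    HasDerivAt (fun s : ℝ => NormedSpace.exp (s • D) u) (D (NormedSpace.exp (t • D) u)) t := by
  simpa using (hasDerivAt_exp_smul_const' (𝕂 := ℝ) D t).clm_apply (hasDerivAt_const t u)

/-- The derivation property says exactly that t ↦ B(exp(tD)u, exp(tD)v) solves f' = D f, so
uniqueness applies at t = 1. -/
theorem bilinear_exp (B : E →L[ℝ] E →L[ℝ] E)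
    (hD : ∀ u v, D (B u v) = B (D u) v + B u (D v)) (u v : E) :
    B (NormedSpace.exp D u) (NormedSpace.exp D v) = NormedSpace.exp D (B u v) := by
  have h := eq_exp_apply_of_hasDerivAt D
    (f := fun t => B (NormedSpace.exp (t • D) u) (NormedSpace.exp (t • D) v)) (fun t => by
      have h₁ := (B.hasFDerivAt.comp_hasDerivAt t (hasDerivAt_exp_smul_apply D u t)).clm_apply
        (hasDerivAt_exp_smul_apply D v t)
      rw [hD]
      exact h₁) 1
  simpa using h

theorem exp_apply_of_rotation {e w : E} (he : D e = w) (hw : D w = -e) (t : ℝ) :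
    NormedSpace.exp (t • D) e = Real.cos t • e + Real.sin t • w := by
  have h := eq_exp_apply_of_hasDerivAt D (f := fun t => Real.cos t • e + Real.sin t • w)
    (fun t => by
      have := ((Real.hasDerivAt_cos t).smul_const e).add ((Real.hasDerivAt_sin t).smul_const w)
      have e' : D (Real.cos t • e + Real.sin t • w) =
          -Real.sin t • e + Real.cos t • w := by
        rw [map_add, map_smul, map_smul, he, hw]
        module
      rw [e']
      exact this) t
  simpa using h.symm

end Exp

/-! ### The Lie algebra -/

/-- The real form of `g2Matrix`. -/
def g2Real (p q : Fin 3 → ℝ) (d0 d1 x y z w s t : ℝ) : Matrix (Fin 7) (Fin 7) ℝ :=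
  !![0, -2 * q 0, 2 * p 0, -2 * q 1, 2 * p 1, -2 * q 2, 2 * p 2;
     2 * q 0, 0, -d0, p 2 + x, -q 2 - y, -p 1 + z, q 1 - w;
     -2 * p 0, d0, 0, -q 2 + y, -p 2 + x, q 1 + w, p 1 + z;
     2 * q 1, -p 2 - x, q 2 - y, 0, -d1, p 0 + s, -q 0 - t;
     -2 * p 1, q 2 + y, p 2 - x, d1, 0, -q 0 + t, -p 0 + s;
     2 * q 2, p 1 - z, -q 1 - w, -p 0 - s, q 0 - t, 0, d0 + d1;
     -2 * p 2, -q 1 + w, -p 1 - z, q 0 + t, p 0 - s, -d0 - d1, 0]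

/-- The inverse of `frame`. -/
noncomputable def frameInv : Matrix (Fin 7) (Fin 7) ℂ :=
  !![1, 0, 0, 0, 0, 0, 0;
     0, 1, Complex.I, 0, 0, 0, 0;
     0, 0, 0, 1, Complex.I, 0, 0;
     0, 0, 0, 0, 0, 1, Complex.I;
     0, 1, -Complex.I, 0, 0, 0, 0;
     0, 0, 0, 1, -Complex.I, 0, 0;
     0, 0, 0, 0, 0, 1, -Complex.I]

theorem frame_mul_frameInv : frame * frameInv = 1 := by
  ext i j
  fin_cases i <;> fin_cases j <;>
    simp [frame, frameInv, Matrix.mul_apply, Fin.sum_univ_succ] <;> ring_nf <;> simp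

theorem frame_inv : frame⁻¹ = frameInv := Matrix.inv_eq_right_inv frame_mul_frameInv

theorem inFrame_eq_iff (A : Matrix (Fin 7) (Fin 7) ℝ) (G : Matrix (Fin 7) (Fin 7) ℂ) :
    inFrame A = G ↔ A.map Complex.ofReal = frame * G * frameInv := by
  have h₁ := frame_mul_frameInv
  have h₂ : frameInv * frame = 1 := mul_eq_one_comm.1 h₁
  rw [inFrame, frame_inv]
  constructor
  · rintro rfl
    simp only [Matrix.mul_assoc, h₁, Matrix.mul_one]
    rw [← Matrix.mul_assoc, h₁, Matrix.one_mul]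
  · intro h
    rw [h]
    simp only [Matrix.mul_assoc, h₂, Matrix.mul_one]
    rw [← Matrix.mul_assoc, h₂, Matrix.one_mul]

theorem frame_mul_apply (G : Matrix (Fin 7) (Fin 7) ℂ) : frame * G = Matrix.of
    ![G 0, (1 / 2 : ℂ) • (G 1 + G 4), (Complex.I / 2) • (G 4 - G 1),
      (1 / 2 : ℂ) • (G 2 + G 5), (Complex.I / 2) • (G 5 - G 2),
      (1 / 2 : ℂ) • (G 3 + G 6), (Complex.I / 2) • (G 6 - G 3)] := by
  ext i j
  fin_cases i <;> simp [frame, Matrix.mul_apply, Fin.sum_univ_succ] <;> ring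

theorem mul_frameInv_apply (G : Matrix (Fin 7) (Fin 7) ℂ) : G * frameInv = Matrix.of fun i =>
    ![G i 0, G i 1 + G i 4, Complex.I * (G i 1 - G i 4), G i 2 + G i 5,
      Complex.I * (G i 2 - G i 5), G i 3 + G i 6, Complex.I * (G i 3 - G i 6)] := by
  ext i j
  fin_cases j <;> simp [frameInv, Matrix.mul_apply, Fin.sum_univ_succ] <;> ring

set_option maxHeartbeats 2000000 in
-- Real coordinates on 𝔤₂: a = p + iq, and D has diagonal i·d0, i·d1, −i(d0 + d1) and upper entries
-- x + iy, z + iw, s + it. In them, skewness and the derivation property become real polynomial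
-- identities.
theorem g2Real_map (p q : Fin 3 → ℝ) (d0 d1 x y z w s t : ℝ) :
    (g2Real p q d0 d1 x y z w s t).map Complex.ofReal =
      frame * g2Matrix (fun k => ⟨p k, q k⟩)
        !![⟨0, d0⟩, ⟨x, y⟩, ⟨z, w⟩; ⟨-x, y⟩, ⟨0, d1⟩, ⟨s, t⟩; ⟨-z, w⟩, ⟨-s, t⟩, ⟨0, -d0 - d1⟩]
        * frameInv := by
  rw [frame_mul_apply, mul_frameInv_apply]
  ext i j
  fin_cases i <;> fin_cases j <;>
    apply Complex.ext <;> simp [g2Real, g2Matrix] <;> ring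

theorem g2Real_mem_g2 (p q : Fin 3 → ℝ) (d0 d1 x y z w s t : ℝ) :
    g2Real p q d0 d1 x y z w s t ∈ g2 := by
  refine ⟨_, _, ?_, ?_, (inFrame_eq_iff _ _).2 (g2Real_map p q d0 d1 x y z w s t)⟩
  · ext i j
    fin_cases i <;> fin_cases j <;> simp [Complex.ext_iff]
  · simp [Matrix.trace, Fin.sum_univ_succ, Complex.ext_iff]

/-- Skew-Hermitian symmetry and zero trace determine the remaining entries of D from the listed
ones. -/
theorem exists_eq_g2Real {A : Matrix (Fin 7) (Fin 7) ℝ} (hA : A ∈ g2) :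
    ∃ p q d0 d1 x y z w s t, A = g2Real p q d0 d1 x y z w s t := by
  obtain ⟨a, D, hD, htr, h⟩ := hA
  refine ⟨fun k => (a k).re, fun k => (a k).im, (D 0 0).im, (D 1 1).im, (D 0 1).re, (D 0 1).im,
    (D 0 2).re, (D 0 2).im, (D 1 2).re, (D 1 2).im, ?_⟩
  rw [inFrame_eq_iff] at h
  have hD' : ∀ i j, star (D j i) = -D i j := fun i j => congrFun (congrFun hD i) j
  apply Matrix.map_injective Complex.ofReal_injective
  refine h.trans (Eq.trans ?_ (g2Real_map ..).symm)
  congr 3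
  simp only [Complex.ext_iff, Matrix.trace, Fin.sum_univ_succ] at hD' htr
  simp at hD' htr
  ext i j
  have := hD' i j
  have := hD' 0 0
  have := hD' 1 1
  have := hD' 2 2
  fin_cases i <;> fin_cases j <;> simp [Complex.ext_iff] at * <;>
    first | (constructor <;> linarith) | linarith

/-- The endomorphism of `V` given by a matrix. -/
noncomputable abbrev toEnd : Matrix (Fin 7) (Fin 7) ℝ ≃⋆ₐ[ℝ] (V →L[ℝ] V) := Matrix.toEuclideanCLM

theorem toEnd_apply (A : Matrix (Fin 7) (Fin 7) ℝ) (v : V) (i : Fin 7) :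
    toEnd A v i = ∑ j, A i j * v j := by
  rw [← WithLp.toLp_ofLp 2 v, Matrix.toEuclideanCLM_toLp]
  rfl

theorem g2_skew {A : Matrix (Fin 7) (Fin 7) ℝ} (hA : A ∈ g2) : A.transpose = -A := by
  obtain ⟨p, q, d0, d1, x, y, z, w, s, t, rfl⟩ := exists_eq_g2Real hA
  ext i j
  fin_cases i <;> fin_cases j <;> simp [g2Real] <;> ring

theorem g2_derivation {A : Matrix (Fin 7) (Fin 7) ℝ} (hA : A ∈ g2) (u v : V) :
    toEnd A (cross u v) = cross (toEnd A u) v + cross u (toEnd A v) := by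
  obtain ⟨p, q, d0, d1, x, y, z, w, s, t, rfl⟩ := exists_eq_g2Real hA
  ext i
  simp only [cross_apply, crossFun, toEnd_apply, PiLp.add_apply, Fin.sum_univ_succ,
    Fin.sum_univ_zero, g2Real]
  fin_cases i <;> simp <;> ring

end SixSphere

namespace SixSphere

open Set Filter Topology

/-! ### The tangent spaces of the sphere -/

theorem fact_finrank_V : Fact (Module.finrank ℝ V = 6 + 1) := ⟨by simp⟩

theorem range_dincl (p : S6) : (dincl p).range = (Submodule.span ℝ {(p : V)})ᗮ := by
  have := fact_finrank_V
  exact range_mvfderiv_subtypeVal p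

theorem dincl_injective (p : S6) : Function.Injective (dincl p) := by
  have := fact_finrank_V
  exact injective_mvfderiv_subtypeVal_sphere p

theorem inner_dincl (p : S6) (u : T p) : inner ℝ (p : V) (dincl p u) = 0 := by
  have h : dincl p u ∈ (Submodule.span ℝ {(p : V)})ᗮ := range_dincl p ▸ ⟨u, rfl⟩
  exact Submodule.mem_orthogonal_singleton_iff_inner_right.1 h

theorem exists_dincl_eq {p : S6} {v : V} (h : inner ℝ (p : V) v = 0) : ∃ u, dincl p u = v := by
  have h' : v ∈ (Submodule.span ℝ {(p : V)})ᗮ :=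
    Submodule.mem_orthogonal_singleton_iff_inner_right.2 h
  rw [← range_dincl] at h'
  exact h'

theorem inner_coe_self (p : S6) : inner ℝ (p : V) (p : V) = 1 := by
  rw [real_inner_self_eq_norm_sq, norm_eq_of_mem_sphere p]
  norm_num

/-- The orthogonal projection of `V` to `T_p S⁶`. -/
noncomputable def proj (p : S6) : V →L[ℝ] T p :=
  LinearMap.toContinuousLinearMap
    (((dincl p : T p →ₗ[ℝ] V).exists_leftInverse_of_injective
      (LinearMap.ker_eq_bot.2 (dincl_injective p))).choose ∘ₗ
      (LinearMap.id - (innerₛₗ ℝ (p : V)).smulRight (p : V)))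

theorem dincl_proj (p : S6) (v : V) : dincl p (proj p v) = v - inner ℝ (p : V) v • (p : V) := by
  have hL := ((dincl p : T p →ₗ[ℝ] V).exists_leftInverse_of_injective
      (LinearMap.ker_eq_bot.2 (dincl_injective p))).choose_spec
  -- The chosen left inverse is controlled only on the image of `dincl p`, so the projected vector
  -- is first written in that image.
  obtain ⟨u, hu⟩ : ∃ u, dincl p u = v - inner ℝ (p : V) v • (p : V) :=
    exists_dincl_eq (by rw [inner_sub_right, inner_smul_right, inner_coe_self]; ring)
  have h : proj p v = ((dincl p : T p →ₗ[ℝ] V).exists_leftInverse_of_injective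
      (LinearMap.ker_eq_bot.2 (dincl_injective p))).choose (dincl p u) := by
    rw [hu]; rfl
  have h' := LinearMap.congr_fun hL u
  rw [h, ← hu]
  exact congrArg _ h'

theorem dincl_proj_of_inner_eq_zero {p : S6} {v : V} (h : inner ℝ (p : V) v = 0) :
    dincl p (proj p v) = v := by
  rw [dincl_proj, h, zero_smul, sub_zero]

theorem proj_dincl (p : S6) (u : T p) : proj p (dincl p u) = u :=
  dincl_injective p (dincl_proj_of_inner_eq_zero (inner_dincl p u))

theorem inner_dincl_proj (p : S6) (u : T p) (v : V) :
    inner ℝ (dincl p u) (dincl p (proj p v)) = inner ℝ (dincl p u) v := by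
  rw [dincl_proj, inner_sub_right, inner_smul_right, real_inner_comm (p : V) (dincl p u), inner_dincl]
  ring

/-! ### Local parametrizations -/

/-- The charts are stereographic, hence onto ℝ⁶; their inverses are globally smooth and ordinary
derivatives suffice throughout. -/
theorem extChartAt_target_eq_univ (p : S6) : (extChartAt (𝓡 6) p).target = univ := by
  have := fact_finrank_V
  have h : (chartAt (EuclideanSpace ℝ (Fin 6)) p).target = univ := stereographic'_target (-p)
  simp [h]

/-- The inverse of the preferred chart at `p`, as a map to `V`. -/
noncomputable def param (p : S6) (z : EuclideanSpace ℝ (Fin 6)) : V :=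
  ((extChartAt (𝓡 6) p).symm z : V)

theorem contMDiff_coe : ContMDiff (𝓡 6) 𝓘(ℝ, V) ∞ (Subtype.val : S6 → V) := by
  have := fact_finrank_V
  exact contMDiff_coe_sphere

theorem contMDiff_extChartAt_symm (p : S6) :
    ContMDiff 𝓘(ℝ, EuclideanSpace ℝ (Fin 6)) (𝓡 6) ∞ (extChartAt (𝓡 6) p).symm := by
  rw [← contMDiffOn_univ, ← extChartAt_target_eq_univ p]
  exact contMDiffOn_extChartAt_symm p

theorem contDiff_param (p : S6) : ContDiff ℝ ∞ (param p) :=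
  (contMDiff_coe.comp (contMDiff_extChartAt_symm p)).contDiff

theorem fderiv_param (p : S6) (z u : EuclideanSpace ℝ (Fin 6)) :
    fderiv ℝ (param p) z u = dincl ((extChartAt (𝓡 6) p).symm z)
      (mfderiv 𝓘(ℝ, EuclideanSpace ℝ (Fin 6)) (𝓡 6) (extChartAt (𝓡 6) p).symm z u) := by
  have h := mfderiv_comp (I := 𝓘(ℝ, EuclideanSpace ℝ (Fin 6))) (I' := 𝓡 6) (I'' := 𝓘(ℝ, V)) z
    (contMDiff_coe.mdifferentiable (by simp) ((extChartAt (𝓡 6) p).symm z))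
    ((contMDiff_extChartAt_symm p).mdifferentiable (by simp) z)
  rw [mfderiv_eq_fderiv] at h
  exact congrArg (fun L : EuclideanSpace ℝ (Fin 6) →L[ℝ] V => L u) h

/-- No transition factor appears, because T_p is identified with the model space through the
preferred chart at p. -/
theorem fderiv_param_self (p : S6) (u : T p) :
    fderiv ℝ (param p) (extChartAt (𝓡 6) p p) u = dincl p u := by
  rw [dincl, (contMDiff_coe.mdifferentiable (by simp) p).mvfderiv]
  simp only [modelWithCornersSelf_coe, range_id, fderivWithin_univ]
  rfl

/-! ### Pull-back of alternating maps -/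

section Pullback

variable {W F : Type*} [NormedAddCommGroup W] [NormedSpace ℝ W]
  [NormedAddCommGroup F] [NormedSpace ℝ F] {k : ℕ}

/-- Normalized alternatization, a continuous retraction onto alternating maps. -/
noncomputable def alternatizeCLM :
    ContinuousMultilinearMap ℝ (fun _ : Fin k => W) F →L[ℝ] W [⋀^Fin k]→L[ℝ] F :=
  LinearMap.mkContinuous
    { toFun := fun f => ((k.factorial : ℝ)⁻¹) • ContinuousMultilinearMap.alternatization f
      map_add' := fun f g => by rw [map_add, smul_add]
      map_smul' := fun c f => by
        ext v
        simp [ContinuousMultilinearMap.alternatization_apply_apply, Finset.smul_sum,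
          Units.smul_def, smul_comm c] }
    1 fun f => by
      refine ContinuousAlternatingMap.opNorm_le_bound _ (by positivity) fun v => ?_
      have h : ‖ContinuousMultilinearMap.alternatization f v‖ ≤
          k.factorial * (‖f‖ * ∏ i, ‖v i‖) := by
        rw [ContinuousMultilinearMap.alternatization_apply_apply]
        refine (norm_sum_le_of_le Finset.univ
          fun σ _ => (?_ : _ ≤ ‖f‖ * ∏ i, ‖v i‖)).trans ?_
        · have h₁ : ‖Equiv.Perm.sign σ • f (v ∘ σ)‖ = ‖f (v ∘ σ)‖ := by
            rcases Int.units_eq_one_or (Equiv.Perm.sign σ) with h | h <;> simp [h]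
          rw [h₁]
          refine (f.le_opNorm _).trans_eq ?_
          congr 1
          exact Equiv.prod_comp σ fun i => ‖v i‖
        · simp [Fintype.card_perm]
      have hk : (0 : ℝ) < k.factorial := by positivity
      have e : ‖((k.factorial : ℝ)⁻¹ • ContinuousMultilinearMap.alternatization f) v‖ =
          (k.factorial : ℝ)⁻¹ * ‖ContinuousMultilinearMap.alternatization f v‖ := by
        rw [ContinuousAlternatingMap.smul_apply, norm_smul]
        simp
      refine e.trans_le ?_
      rw [inv_mul_le_iff₀ hk, one_mul]
      exact h

theorem alternatizeCLM_coe (f : W [⋀^Fin k]→L[ℝ] F) :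
    alternatizeCLM f.toContinuousMultilinearMap = f := by
  ext v
  have hk : (k.factorial : ℝ) ≠ 0 := by positivity
  have h : alternatizeCLM f.toContinuousMultilinearMap v =
      (k.factorial : ℝ)⁻¹ • ∑ σ : Equiv.Perm (Fin k), Equiv.Perm.sign σ • f (v ∘ σ) := by
    change (k.factorial : ℝ)⁻¹ •
      ContinuousMultilinearMap.alternatization f.toContinuousMultilinearMap v = _
    rw [ContinuousMultilinearMap.alternatization_apply_apply]
    rfl
  rw [h]
  have h₂ : ∀ σ : Equiv.Perm (Fin k), Equiv.Perm.sign σ • f (v ∘ σ) = f v := fun σ => by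
    have h₁ := f.toAlternatingMap.map_perm v σ
    change f (v ∘ σ) = Equiv.Perm.sign σ • f v at h₁
    rw [h₁, smul_smul, Int.units_mul_self, one_smul]
  simp only [h₂, Finset.sum_const, Finset.card_univ, Fintype.card_perm, Fintype.card_fin]
  rw [← Nat.cast_smul_eq_nsmul ℝ, smul_smul, inv_mul_cancel₀ hk, one_smul]

/-- Pull-back of multilinear maps is smooth in the linear map and linear in the form; the retraction
`alternatizeCLM` carries this smoothness to alternating maps. -/
theorem contDiff_compContinuousLinearMap {G H : Type*} [NormedAddCommGroup G] [NormedSpace ℝ G]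
    [NormedAddCommGroup H] [NormedSpace ℝ H] {n : ℕ∞ω}
    {a : H → W [⋀^Fin k]→L[ℝ] F} {L : H → G →L[ℝ] W} (ha : ContDiff ℝ n a)
    (hL : ContDiff ℝ n L) : ContDiff ℝ n fun z => (a z).compContinuousLinearMap (L z) := by
  have h₁ : ContDiff ℝ n fun z =>
      ContinuousMultilinearMap.compContinuousLinearMapContinuousMultilinear ℝ
        (fun _ : Fin k => G) (fun _ : Fin k => W) F (fun _ => L z) :=
    (ContinuousMultilinearMap.contDiff _).comp (contDiff_pi.2 fun _ => hL)
  have h₂ : ContDiff ℝ n fun z => (a z).toContinuousMultilinearMap :=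
    (ContinuousAlternatingMap.toContinuousMultilinearMapCLM (E := W) (F := F) (ι := Fin k)
      (𝕜 := ℝ) ℝ).contDiff.comp ha
  have h₃ := (alternatizeCLM (k := k) (W := G) (F := F)).contDiff (n := n) |>.comp (h₁.clm_apply h₂)
  have e : (fun z => (a z).compContinuousLinearMap (L z)) =
      fun z => alternatizeCLM (((a z).compContinuousLinearMap (L z)).toContinuousMultilinearMap) :=
    funext fun z => (alternatizeCLM_coe _).symm
  rw [e]
  exact h₃

end Pullback

/-! ### Restriction of ambient forms -/

section Forms

variable {F : Type*} [NormedAddCommGroup F] [NormedSpace ℝ F] {k : ℕ}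

/-- The restriction of a differential form on `V` to the sphere. -/
noncomputable def restrictForm (a : V → V [⋀^Fin k]→L[ℝ] F) (p : S6) : T p [⋀^Fin k]→L[ℝ] F :=
  (a p).compContinuousLinearMap (dincl p)

theorem localForm_restrictForm (a : V → V [⋀^Fin k]→L[ℝ] F) (p : S6) :
    ManifoldForm.localForm (𝓡 6) (restrictForm a) p =
      fun z => (a (param p z)).compContinuousLinearMap (fderiv ℝ (param p) z) := by
  ext z v
  simp only [ManifoldForm.localForm, restrictForm,
    ContinuousAlternatingMap.compContinuousLinearMap_apply, Function.comp_def, fderiv_param]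
  rfl

theorem isSmooth_restrictForm {a : V → V [⋀^Fin k]→L[ℝ] F} (ha : ContDiff ℝ ∞ a) :
    ManifoldForm.IsSmooth (𝓡 6) (restrictForm a) := by
  intro p
  rw [localForm_restrictForm]
  exact (contDiff_compContinuousLinearMap (ha.comp (contDiff_param p))
    ((contDiff_param p).fderiv_right le_rfl)).contDiffOn

/-- The local expression of a restricted form is its pull-back along `param p`, and the exterior
derivative commutes with pull-backs. -/
theorem d_restrictForm {a : V → V [⋀^Fin k]→L[ℝ] F} (p : S6)
    (ha : DifferentiableAt ℝ a p) (v : Fin (k + 1) → T p) :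
    ManifoldForm.d (𝓡 6) (restrictForm a) p v = extDeriv a p fun i => dincl p (v i) := by
  have hp : param p (extChartAt (𝓡 6) p p) = p := by simp [param]
  rw [ManifoldForm.d, localForm_restrictForm, extDeriv_pullback (by rwa [hp])
    (contDiff_param p).contDiffAt (by rw [minSmoothness_of_isRCLikeNormedField]; exact WithTop.coe_le_coe.2 (le_top : (2 : ℕ∞) ≤ ⊤)), hp, mfderiv_extChartAt_self]
  exact congrArg (extDeriv a p) (funext fun i => fderiv_param_self p (v i))

end Forms

end SixSphere

namespace SixSphere

open Set Filter Topology

/-! ### Vector fields on the sphere as maps to `V` -/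

/-- A vector field on the sphere, as a map to `V`. -/
noncomputable def embed (X : ∀ q : S6, T q) (q : S6) : V := dincl q (X q)

/-- The expression of a vector field in the preferred chart at `p`. -/
noncomputable def chartField (p : S6) (X : ∀ q : S6, TangentSpace (𝓡 6) q) :
    EuclideanSpace ℝ (Fin 6) → EuclideanSpace ℝ (Fin 6) :=
  VectorField.mpullbackWithin 𝓘(ℝ, EuclideanSpace ℝ (Fin 6)) (𝓡 6) (extChartAt (𝓡 6) p).symm X
    (range (𝓡 6))

theorem differentiableAt_chartField {p : S6} {X : ∀ q : S6, TangentSpace (𝓡 6) q}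
    (hX : IsDiffAt X p) : DifferentiableAt ℝ (chartField p X) (extChartAt (𝓡 6) p p) := by
  have h := MDifferentiableWithinAt.differentiableWithinAt_mpullbackWithin_vectorField
    (I := 𝓡 6) (V := X) (s := univ) (x := p) (mdifferentiableWithinAt_univ.2 hX)
  have hr : range (𝓡 6) = univ := by rw [modelWithCornersSelf_coe, range_id]
  rw [preimage_univ, univ_inter, hr] at h
  rw [chartField, hr]
  exact differentiableWithinAt_univ.1 h

theorem embed_extChartAt_symm (p : S6) (X : ∀ q : S6, TangentSpace (𝓡 6) q)
    (z : EuclideanSpace ℝ (Fin 6)) :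
    embed X ((extChartAt (𝓡 6) p).symm z) = fderiv ℝ (param p) z (chartField p X z) := by
  have h : z ∈ (extChartAt (𝓡 6) p).target := by rw [extChartAt_target_eq_univ]; trivial
  have hi := isInvertible_mfderivWithin_extChartAt_symm h
  have e : mfderivWithin 𝓘(ℝ, EuclideanSpace ℝ (Fin 6)) (𝓡 6) (extChartAt (𝓡 6) p).symm
      (range (𝓡 6)) z =
      mfderiv 𝓘(ℝ, EuclideanSpace ℝ (Fin 6)) (𝓡 6) (extChartAt (𝓡 6) p).symm z := by
    rw [modelWithCornersSelf_coe, range_id, mfderivWithin_univ]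
  rw [fderiv_param, embed, ← e]
  exact congrArg _ (hi.self_apply_inverse (X ((extChartAt (𝓡 6) p).symm z))).symm

theorem chartField_self (p : S6) (X : ∀ q : S6, TangentSpace (𝓡 6) q) :
    chartField p X (extChartAt (𝓡 6) p p) = X p := by
  refine dincl_injective p ((fderiv_param_self p _).symm.trans ?_)
  rw [← embed_extChartAt_symm, extChartAt_to_inv]
  rfl

theorem mvfderiv_eq_fderiv {F : Type*} [NormedAddCommGroup F] [NormedSpace ℝ F] {g : S6 → F}
    {p : S6} (hg : MDifferentiableAt (𝓡 6) 𝓘(ℝ, F) g p) (v : T p) :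
    mvfderiv (𝓡 6) g p v = 
      fderiv ℝ (fun z => g ((extChartAt (𝓡 6) p).symm z)) (extChartAt (𝓡 6) p p) v := by
  rw [hg.mvfderiv]
  simp only [modelWithCornersSelf_coe, range_id, fderivWithin_univ]
  rfl

theorem MDifferentiableAt.differentiableAt_extChartAt_symm {F : Type*} [NormedAddCommGroup F]
    [NormedSpace ℝ F] {g : S6 → F} {p : S6} (hg : MDifferentiableAt (𝓡 6) 𝓘(ℝ, F) g p) :
    DifferentiableAt ℝ (fun z => g ((extChartAt (𝓡 6) p).symm z)) (extChartAt (𝓡 6) p p) := by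
  have h := hg.differentiableWithinAt_writtenInExtChartAt
  rw [modelWithCornersSelf_coe, range_id] at h
  exact differentiableWithinAt_univ.1 h

theorem mvfderiv_bilinear {F₁ F₂ F₃ : Type*} [NormedAddCommGroup F₁] [NormedSpace ℝ F₁]
    [NormedAddCommGroup F₂] [NormedSpace ℝ F₂] [NormedAddCommGroup F₃] [NormedSpace ℝ F₃]
    (B : F₁ →L[ℝ] F₂ →L[ℝ] F₃) {g₁ : S6 → F₁} {g₂ : S6 → F₂} {p : S6}
    (h₁ : MDifferentiableAt (𝓡 6) 𝓘(ℝ, F₁) g₁ p) (h₂ : MDifferentiableAt (𝓡 6) 𝓘(ℝ, F₂) g₂ p)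
    (v : T p) : mvfderiv (𝓡 6) (fun q => B (g₁ q) (g₂ q)) p v =
      B (mvfderiv (𝓡 6) g₁ p v) (g₂ p) + B (g₁ p) (mvfderiv (𝓡 6) g₂ p v) := by
  have hd : DifferentiableAt ℝ (fun x : F₁ × F₂ => B x.1 x.2) ((fun q => (g₁ q, g₂ q)) p) :=
    B.isBoundedBilinearMap.differentiableAt _
  have hB : MDifferentiableAt (𝓡 6) 𝓘(ℝ, F₃) (fun q => B (g₁ q) (g₂ q)) p :=
    hd.comp_mdifferentiableAt (f := fun q => (g₁ q, g₂ q)) (x := p) (h₁.prodMk_space h₂)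
  have d₁ := MDifferentiableAt.differentiableAt_extChartAt_symm h₁
  have d₂ := MDifferentiableAt.differentiableAt_extChartAt_symm h₂
  have h := (B.hasFDerivAt_of_bilinear d₁.hasFDerivAt d₂.hasFDerivAt).fderiv
  rw [mvfderiv_eq_fderiv hB, mvfderiv_eq_fderiv h₁, mvfderiv_eq_fderiv h₂, h]
  simp only [extChartAt_to_inv]
  exact add_comm _ _

theorem mdifferentiableAt_embed {p : S6} {X : ∀ q : S6, TangentSpace (𝓡 6) q}
    (hX : IsDiffAt X p) : MDifferentiableAt (𝓡 6) 𝓘(ℝ, V) (embed X) p := by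
  have h₁ : DifferentiableAt ℝ (fun z => fderiv ℝ (param p) z (chartField p X z))
      (extChartAt (𝓡 6) p p) :=
    (((contDiff_param p).fderiv_right (m := 1) (by exact WithTop.coe_le_coe.2 le_top)).differentiable
      (by simp) _).clm_apply (differentiableAt_chartField hX)
  have h₂ := h₁.mdifferentiableAt.comp p (mdifferentiableAt_extChartAt (I := 𝓡 6) (mem_chart_source _ p))
  refine h₂.congr_of_eventuallyEq ?_
  filter_upwards [extChartAt_source_mem_nhds (I := 𝓡 6) p] with q hq
  rw [Function.comp_apply, ← embed_extChartAt_symm, (extChartAt (𝓡 6) p).left_inv hq]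

/-- Product rule for Dψ·ξ, with ψ the parametrization and ξ the chart expression of X. The first
term is symmetric in v and X p, so it cancels in the torsion. -/
theorem mvfderiv_embed {p : S6} {X : ∀ q : S6, TangentSpace (𝓡 6) q}
    (hX : IsDiffAt X p) (v : T p) : mvfderiv (𝓡 6) (embed X) p v =
      fderiv ℝ (fderiv ℝ (param p)) (extChartAt (𝓡 6) p p) v (X p) +
        dincl p (fderiv ℝ (chartField p X) (extChartAt (𝓡 6) p p) v) := by
  have h₁ := ((contDiff_param p).fderiv_right (m := 1)
    (by exact WithTop.coe_le_coe.2 le_top)).differentiable (by simp) (extChartAt (𝓡 6) p p)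
  rw [mvfderiv_eq_fderiv (mdifferentiableAt_embed hX)]
  simp only [embed_extChartAt_symm]
  have e := congrArg (fun L : EuclideanSpace ℝ (Fin 6) →L[ℝ] V => L v)
    (fderiv_clm_apply h₁ (differentiableAt_chartField hX))
  rw [chartField_self] at e
  refine e.trans ((add_comm _ _).trans ?_)
  exact congrArg _ (fderiv_param_self p _)

/-- The Levi-Civita connection of the round metric: the tangential part of the derivative in `V`. -/
noncomputable def leviCivita : CovariantDerivative (𝓡 6) (EuclideanSpace ℝ (Fin 6))
    (TangentSpace (𝓡 6) : S6 → Type _) where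
  toFun X p := (proj p).comp (mvfderiv (𝓡 6) (embed X) p)
  isCovariantDerivativeOnUniv :=
    { add := fun {X Y p} hX hY _ => by
        have h : embed (X + Y) = embed X + embed Y := by
          funext q; simp [embed]
        rw [h, mvfderiv_add (mdifferentiableAt_embed hX) (mdifferentiableAt_embed hY)]
        exact ContinuousLinearMap.comp_add _ _ _
      leibniz := fun {X g p} hX hg _ => by
        have h : embed (g • X) = g • embed X := by
          funext q; simp [embed]
        rw [h, mvfderiv_smul hg (mdifferentiableAt_embed hX)]
        ext v
        simp [embed, proj_dincl] }

theorem leviCivita_apply (X : ∀ q : S6, TangentSpace (𝓡 6) q) (p : S6) (v : T p) :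
    leviCivita X p v = proj p (mvfderiv (𝓡 6) (embed X) p v) := rfl

/-- The preferred chart at p has identity derivative at p, so the bracket there is the bracket of
the chart expressions. -/
theorem mlieBracket_eq (X Y : ∀ q : S6, TangentSpace (𝓡 6) q) (p : S6) :
    VectorField.mlieBracket (𝓡 6) X Y p =
      VectorField.lieBracket (E := EuclideanSpace ℝ (Fin 6)) ℝ (chartField p X) (chartField p Y) (extChartAt (𝓡 6) p p) := by
  have h : ∀ w : EuclideanSpace ℝ (Fin 6),
      (mfderiv (𝓡 6) 𝓘(ℝ, EuclideanSpace ℝ (Fin 6)) (extChartAt (𝓡 6) p) p).inverse w = w := by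
    intro w
    have h' : (ContinuousLinearMap.id ℝ (EuclideanSpace ℝ (Fin 6))).inverse w = w := by
      rw [ContinuousLinearMap.inverse_id]
      rfl
    exact (congrArg (fun L : EuclideanSpace ℝ (Fin 6) →L[ℝ] EuclideanSpace ℝ (Fin 6) =>
      L.inverse w) (mfderiv_extChartAt_self (I := 𝓡 6) (x := p))).trans h'
  rw [VectorField.mlieBracket, VectorField.mlieBracketWithin_apply]
  refine (h _).trans ?_
  rw [preimage_univ, univ_inter]
  have hr : range (𝓡 6) = univ := by rw [modelWithCornersSelf_coe, range_id]
  rw [chartField, chartField, hr]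
  exact congrFun (VectorField.lieBracketWithin_univ (𝕜 := ℝ) (E := EuclideanSpace ℝ (Fin 6))) _

/-- Zero torsion is the symmetry of the second derivative of the parametrization. Metric
compatibility is the product rule in V, since pairing with a tangent vector does not see the
projection. -/
theorem isLeviCivita_leviCivita : IsLeviCivita leviCivita := by
  constructor
  · rw [CovariantDerivative.torsion_eq_zero_iff]
    intro X Y p hX hY
    rw [leviCivita_apply, leviCivita_apply, ← map_sub, mvfderiv_embed hX, mvfderiv_embed hY,
      mlieBracket_eq]
    have hs : IsSymmSndFDerivAt ℝ (param p) (extChartAt (𝓡 6) p p) :=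
      (contDiff_param p).contDiffAt.isSymmSndFDerivAt
        (by rw [minSmoothness_of_isRCLikeNormedField]; exact WithTop.coe_le_coe.2 le_top)
    rw [hs.eq (X p) (Y p), add_sub_add_left_eq_sub, VectorField.lieBracket,
      chartField_self, chartField_self]
    exact (congrArg (proj p) (map_sub (dincl p) _ _).symm).trans (proj_dincl p _)
  · intro p X Y hX hY v
    have hX' := mdifferentiableAt_embed hX
    have hY' := mdifferentiableAt_embed hY
    have h := mvfderiv_bilinear (innerSL ℝ) hX' hY' v
    have e : (fun q => gcan q (X q) (Y q)) = fun q => inner ℝ (embed X q) (embed Y q) := rfl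
    have e₁ : gcan p (leviCivita X p v) (Y p) =
        inner ℝ (mvfderiv (𝓡 6) (embed X) p v) (embed Y p) := by
      rw [gcan_comm, real_inner_comm]
      exact inner_dincl_proj p (Y p) _
    have e₂ : gcan p (X p) (leviCivita Y p v) =
        inner ℝ (embed X p) (mvfderiv (𝓡 6) (embed Y) p v) := inner_dincl_proj p (X p) _
    rw [e, e₁, e₂]
    exact h

/-! ### The octonionic almost complex structure -/

/-- The almost complex structure `J_p v = p × v`. -/
noncomputable def octJ (p : S6) : T p →L[ℝ] T p := (proj p).comp ((cross (p : V)).comp (dincl p))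

theorem dincl_octJ (p : S6) (u : T p) : dincl p (octJ p u) = cross p (dincl p u) :=
  dincl_proj_of_inner_eq_zero (inner_cross_left _ _)

theorem octJ_octJ (p : S6) (u : T p) : octJ p (octJ p u) = -u := by
  apply dincl_injective p
  rw [dincl_octJ, dincl_octJ, cross_cross, inner_dincl, inner_coe_self, map_neg]
  module

theorem gcan_octJ (p : S6) (u v : T p) : gcan p (octJ p u) (octJ p v) = gcan p u v := by
  rw [gcan, dincl_octJ, dincl_octJ, inner_cross_cross, inner_coe_self, inner_dincl, gcan]
  ring

theorem leviCivita_octJ {p : S6} {X : ∀ q : S6, TangentSpace (𝓡 6) q} (hX : IsDiffAt X p) :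
    leviCivita (fun q => octJ q (X q)) p (X p) - octJ p (leviCivita X p (X p)) = 0 := by
  have e : embed (fun q => octJ q (X q)) = fun q : S6 => cross q (embed X q) :=
    funext fun q => dincl_octJ q (X q)
  have h := mvfderiv_bilinear cross (contMDiff_coe.mdifferentiable (by simp) p)
    (mdifferentiableAt_embed hX) (X p)
  -- The inclusion has derivative X in the direction X, so this term is X × X.
  have h₀ : cross (mvfderiv (𝓡 6) (Subtype.val : S6 → V) p (X p)) (embed X p) = 0 :=
    cross_self _
  rw [h₀, zero_add] at h
  apply dincl_injective p
  rw [map_sub, dincl_octJ, leviCivita_apply, leviCivita_apply, e, h,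
    dincl_proj_of_inner_eq_zero (inner_cross_left _ _), dincl_proj, map_sub, map_smul, cross_self,
    smul_zero, sub_zero, sub_self, map_zero]

end SixSphere

namespace SixSphere

open Set Filter Topology

/-! ### Smoothness of the almost complex structure -/

/-- The expression of `J` near `p`, in the trivialization of the tangent bundle at `p`. -/
noncomputable def localJ (p q : S6) : EuclideanSpace ℝ (Fin 6) →L[ℝ] EuclideanSpace ℝ (Fin 6) :=
  ContinuousLinearMap.inCoordinates (EuclideanSpace ℝ (Fin 6)) (TangentSpace (𝓡 6) : S6 → Type _)
    (EuclideanSpace ℝ (Fin 6)) (TangentSpace (𝓡 6) : S6 → Type _) p q p q (octJ q)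

theorem fderiv_param_continuousLinearMapAt {p q : S6} (hq : q ∈ (extChartAt (𝓡 6) p).source)
    (v : T q) : fderiv ℝ (param p) (extChartAt (𝓡 6) p q)
      ((trivializationAt (EuclideanSpace ℝ (Fin 6)) (TangentSpace (𝓡 6) : S6 → Type _)
        p).continuousLinearMapAt ℝ q v) = dincl q v := by
  have hq' : q ∈ (chartAt (EuclideanSpace ℝ (Fin 6)) p).source := by
    rwa [extChartAt_source] at hq
  rw [TangentBundle.continuousLinearMapAt_trivializationAt hq']
  have h := mfderiv_comp (I := 𝓡 6) (I' := 𝓘(ℝ, EuclideanSpace ℝ (Fin 6))) (I'' := 𝓘(ℝ, V)) q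
    (((contDiff_param p).differentiable (by simp) (extChartAt (𝓡 6) p q)).mdifferentiableAt)
    (mdifferentiableAt_extChartAt hq')
  rw [mfderiv_eq_fderiv] at h
  have e : param p ∘ extChartAt (𝓡 6) p =ᶠ[𝓝 q] (Subtype.val : S6 → V) := by
    filter_upwards [(isOpen_extChartAt_source p).mem_nhds hq] with r hr
    rw [Function.comp_apply, param, (extChartAt (𝓡 6) p).left_inv hr]
  have h' := (congrArg (fun L : EuclideanSpace ℝ (Fin 6) →L[ℝ] V => L v) h).symm
  refine h'.trans ?_
  exact congrArg (fun L : EuclideanSpace ℝ (Fin 6) →L[ℝ] V => L v) (e.mfderiv_eq)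

theorem fderiv_param_localJ {p q : S6} (hq : q ∈ (extChartAt (𝓡 6) p).source)
    (u : EuclideanSpace ℝ (Fin 6)) :
    fderiv ℝ (param p) (extChartAt (𝓡 6) p q) (localJ p q u) =
      cross q (fderiv ℝ (param p) (extChartAt (𝓡 6) p q) u) := by
  have hq' : q ∈ (trivializationAt (EuclideanSpace ℝ (Fin 6))
      (TangentSpace (𝓡 6) : S6 → Type _) p).baseSet := by
    rwa [extChartAt_source] at hq
  have hu := (trivializationAt (EuclideanSpace ℝ (Fin 6))
      (TangentSpace (𝓡 6) : S6 → Type _) p).continuousLinearMapAt_symmL (R := ℝ) hq' u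
  have h := fderiv_param_continuousLinearMapAt hq ((trivializationAt (EuclideanSpace ℝ (Fin 6))
      (TangentSpace (𝓡 6) : S6 → Type _) p).symmL ℝ q u)
  rw [hu] at h
  rw [h, ← dincl_octJ, ← fderiv_param_continuousLinearMapAt hq]
  rfl

/-- A left inverse of the differential of `param p` at the base point. -/
noncomputable def leftInv (p : S6) : V →L[ℝ] EuclideanSpace ℝ (Fin 6) := proj p

theorem leftInv_comp_self (p : S6) :
    (leftInv p).comp (fderiv ℝ (param p) (extChartAt (𝓡 6) p p)) = 1 := by
  ext1 u
  exact (congrArg (proj p) (fderiv_param_self p u)).trans (proj_dincl p u)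

theorem contMDiffAt_fderiv_param (p : S6) : ContMDiffAt (𝓡 6)
    𝓘(ℝ, EuclideanSpace ℝ (Fin 6) →L[ℝ] V) ∞
    (fun q => fderiv ℝ (param p) (extChartAt (𝓡 6) p q)) p :=
  ((contDiff_param p).fderiv_right (m := ∞) le_rfl).contMDiff.contMDiffAt.comp p
    contMDiffAt_extChartAt

theorem contMDiffAt_leftInv_comp (p : S6) : ContMDiffAt (𝓡 6)
    𝓘(ℝ, EuclideanSpace ℝ (Fin 6) →L[ℝ] EuclideanSpace ℝ (Fin 6)) ∞
    (fun q => (leftInv p).comp (fderiv ℝ (param p) (extChartAt (𝓡 6) p q))) p :=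
  contMDiffAt_const.clm_comp (contMDiffAt_fderiv_param p)

/-- The relation Dψ ∘ J = (q × ·) ∘ Dψ is solved for J: composed with a fixed left inverse, Dψ is
the identity at p and hence invertible nearby. Every factor of the result is visibly smooth. -/
theorem localJ_eventuallyEq (p : S6) : localJ p =ᶠ[𝓝 p] fun q =>
    Ring.inverse ((leftInv p).comp (fderiv ℝ (param p) (extChartAt (𝓡 6) p q))) *
      (leftInv p).comp ((cross (q : V)).comp (fderiv ℝ (param p) (extChartAt (𝓡 6) p q))) := by
  have hc := (contMDiffAt_leftInv_comp p).continuousAt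
  have hu := hc.eventually (Units.isOpen.mem_nhds (by
    change IsUnit ((leftInv p).comp (fderiv ℝ (param p) (extChartAt (𝓡 6) p p)))
    rw [leftInv_comp_self]
    exact isUnit_one))
  filter_upwards [hu, extChartAt_source_mem_nhds (I := 𝓡 6) p] with q hq hq'
  have h : ((leftInv p).comp (fderiv ℝ (param p) (extChartAt (𝓡 6) p q))) * localJ p q =
      (leftInv p).comp ((cross (q : V)).comp (fderiv ℝ (param p) (extChartAt (𝓡 6) p q))) := by
    ext1 u
    exact congrArg (leftInv p) (fderiv_param_localJ hq' u)
  rw [← h, ← mul_assoc, Ring.inverse_mul_cancel _ hq, one_mul]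

theorem contMDiffAt_localJ (p : S6) : ContMDiffAt (𝓡 6)
    𝓘(ℝ, EuclideanSpace ℝ (Fin 6) →L[ℝ] EuclideanSpace ℝ (Fin 6)) ∞ (localJ p) p := by
  refine ContMDiffAt.congr_of_eventuallyEq ?_ (localJ_eventuallyEq p)
  have h₁ : ContMDiffAt (𝓡 6)
      𝓘(ℝ, EuclideanSpace ℝ (Fin 6) →L[ℝ] EuclideanSpace ℝ (Fin 6)) ∞ (fun q => Ring.inverse
        ((leftInv p).comp (fderiv ℝ (param p) (extChartAt (𝓡 6) p q)))) p := by
    have h := contDiffAt_ringInverse ℝ (n := ∞)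
      (1 : (EuclideanSpace ℝ (Fin 6) →L[ℝ] EuclideanSpace ℝ (Fin 6))ˣ)
    rw [Units.val_one, ← leftInv_comp_self p] at h
    exact h.contMDiffAt.comp p (contMDiffAt_leftInv_comp p)
  have h₂ : ContMDiffAt (𝓡 6) 𝓘(ℝ, V →L[ℝ] V) ∞ (fun q : S6 => cross (q : V)) p :=
    cross.contDiff.contMDiff.contMDiffAt.comp p (contMDiff_coe p)
  exact h₁.clm_comp (contMDiffAt_const.clm_comp (h₂.clm_comp (contMDiffAt_fderiv_param p)))

theorem smooth_octJ : ContMDiff (𝓡 6)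
    ((𝓡 6).prod 𝓘(ℝ, EuclideanSpace ℝ (Fin 6) →L[ℝ] EuclideanSpace ℝ (Fin 6))) ∞
    (fun p => Bundle.TotalSpace.mk' (EuclideanSpace ℝ (Fin 6) →L[ℝ] EuclideanSpace ℝ (Fin 6))
      (E := fun p : S6 => T p →L[ℝ] T p) p (octJ p)) := by
  intro p
  rw [contMDiffAt_hom_bundle]
  exact ⟨contMDiffAt_id, contMDiffAt_localJ p⟩

/-- The octonionic almost Hermitian structure. -/
noncomputable def octHermitian : AlmostHermitian where
  J := octJ
  smooth_J := smooth_octJ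
  J_sq := octJ_octJ
  J_orth := gcan_octJ

theorem octHermitian_isNearlyKahler : octHermitian.IsNearlyKahler :=
  ⟨leviCivita, isLeviCivita_leviCivita, fun _ _ hX => leviCivita_octJ hX⟩

theorem octHermitian_omega : octHermitian.omega = restrictForm fun x => ambientOmega x := by
  funext p
  ext v
  exact congrArg (fun w : V => inner ℝ w (dincl p (v 1))) (dincl_octJ p (v 0))

end SixSphere

namespace SixSphere

open Set Filter Topology

/-! ### The action of `G₂` on `V` -/

theorem toEnd_exp (A : Matrix (Fin 7) (Fin 7) ℝ) :
    toEnd (NormedSpace.exp A) = NormedSpace.exp (toEnd A) := by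
  let _ : NormedRing (Matrix (Fin 7) (Fin 7) ℝ) := Matrix.linftyOpNormedRing
  let _ : NormedAlgebra ℝ (Matrix (Fin 7) (Fin 7) ℝ) := Matrix.linftyOpNormedAlgebra
  let _ : NormedAlgebra ℚ (Matrix (Fin 7) (Fin 7) ℝ) := NormedAlgebra.restrictScalars ℚ ℝ _
  let _ : NormedAlgebra ℚ (V →L[ℝ] V) := NormedAlgebra.restrictScalars ℚ ℝ _
  exact NormedSpace.map_exp toEnd
    (LinearMap.continuous_of_finiteDimensional (toEnd.toAlgEquiv.toLinearMap)) A

/-- The action of `g ∈ G₂` on `V`. -/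
noncomputable def act (g : G2) : V →L[ℝ] V := toEnd (mat g)

theorem mat_mul (g h : G2) : mat (g * h) = mat g * mat h := rfl

theorem mat_inv_mul (g : G2) : mat g⁻¹ * mat g = 1 := by
  rw [← mat_mul, inv_mul_cancel]
  rfl

theorem mat_inv (g : G2) : (mat g)⁻¹ = mat g⁻¹ := Matrix.inv_eq_left_inv (mat_inv_mul g)

theorem act_mul (g h : G2) (v : V) : act (g * h) v = act g (act h v) := by
  rw [act, mat_mul, map_mul]
  rfl

theorem act_inv_act (g : G2) (v : V) : act g⁻¹ (act g v) = v := by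
  rw [← act_mul, inv_mul_cancel, act]
  change toEnd 1 v = v
  rw [map_one]
  rfl

theorem act_act_inv (g : G2) (v : V) : act g (act g⁻¹ v) = v := by
  simpa using act_inv_act g⁻¹ v

theorem inner_act_act (g : G2) (u v : V) : inner ℝ (act g u) (act g v) = inner ℝ u v := by
  have h : star (mat g) * mat g = 1 := Matrix.mem_unitaryGroup_iff'.1 g.1.2
  have h' : star (act g) * act g = 1 := by rw [act, ← map_star, ← map_mul, h, map_one]
  rw [← ContinuousLinearMap.adjoint_inner_left, ← ContinuousLinearMap.star_eq_adjoint]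
  exact congrArg (fun L : V →L[ℝ] V => inner ℝ (L u) v) h'

/-- Automorphisms of the product are closed under composition and inversion, so the exponential
generators suffice. -/
theorem cross_act (g : G2) (u v : V) : cross (act g u) (act g v) = act g (cross u v) := by
  obtain ⟨g, hg⟩ := g
  suffices h : ∀ u v, cross (toEnd g.1 u) (toEnd g.1 v) = toEnd g.1 (cross u v) from h u v
  induction hg using Subgroup.closure_induction with
  | mem x hx =>
    obtain ⟨A, hA, hx⟩ := hx
    intro u v
    rw [hx, toEnd_exp]
    exact bilinear_exp cross (g2_derivation hA) u v
  | one => 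
    intro u v
    change cross (toEnd 1 u) (toEnd 1 v) = toEnd 1 (cross u v)
    rw [map_one]
    rfl
  | mul x y _ _ hx hy =>
    intro u v
    change cross (toEnd (x.1 * y.1) u) (toEnd (x.1 * y.1) v) = toEnd (x.1 * y.1) (cross u v)
    rw [map_mul]
    exact (hx _ _).trans (congrArg _ (hy u v))
  | inv x _ hx =>
    intro u v
    have h₁ : ∀ w, toEnd x.1 (toEnd (x⁻¹).1 w) = w := fun w => by
      change (toEnd x.1 * toEnd (x⁻¹).1) w = w
      rw [← map_mul]
      change toEnd (x * x⁻¹).1 w = w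
      rw [mul_inv_cancel]
      change toEnd 1 w = w
      rw [map_one]
      rfl
    have h₂ : ∀ w, toEnd (x⁻¹).1 (toEnd x.1 w) = w := fun w => by
      change (toEnd (x⁻¹).1 * toEnd x.1) w = w
      rw [← map_mul]
      change toEnd (x⁻¹ * x).1 w = w
      rw [inv_mul_cancel]
      change toEnd 1 w = w
      rw [map_one]
      rfl
    have h := hx (toEnd (x⁻¹).1 u) (toEnd (x⁻¹).1 v)
    rw [h₁, h₁] at h
    rw [h, h₂]

/-- The first basis vector of `V`. -/
noncomputable def e₁ : V := EuclideanSpace.single 0 1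

theorem coe_orbit (g : G2) : (orbit g : V) = act g e₁ := by
  ext i
  rw [act, toEnd_apply]
  simp [orbit, e₁]

theorem inner_e₁ (w : V) : inner ℝ e₁ w = w 0 := by
  rw [inner_eq]
  simp [e₁]

/-! ### One-parameter subgroups -/

theorem exp_mem_orthogonalGroup {A : Matrix (Fin 7) (Fin 7) ℝ} (hA : A ∈ g2) :
    NormedSpace.exp A ∈ Matrix.orthogonalGroup (Fin 7) ℝ := by
  rw [Matrix.mem_orthogonalGroup_iff', ← Matrix.exp_transpose, g2_skew hA,
    Matrix.exp_neg, Matrix.nonsing_inv_mul _ ((Matrix.isUnit_iff_isUnit_det _).1 (Matrix.isUnit_exp A))]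

/-- The exponential of an element of `𝔤₂`. -/
noncomputable def expG2 (A : Matrix (Fin 7) (Fin 7) ℝ) (hA : A ∈ g2) : G2 :=
  ⟨⟨NormedSpace.exp A, exp_mem_orthogonalGroup hA⟩, Subgroup.subset_closure ⟨A, hA, rfl⟩⟩

/-- An element of `𝔤₂` with prescribed first column `(0, w)`. -/
noncomputable def gen (w : V) : Matrix (Fin 7) (Fin 7) ℝ :=
  g2Real ![-w 2 / 2, -w 4 / 2, -w 6 / 2] ![w 1 / 2, w 3 / 2, w 5 / 2] 0 0 0 0 0 0 0 0

theorem gen_mem (w : V) : gen w ∈ g2 := g2Real_mem_g2 ..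

theorem gen_smul (t : ℝ) (w : V) : gen (t • w) = t • gen w := by
  ext i j
  fin_cases i <;> fin_cases j <;> simp [gen, g2Real] <;> ring

theorem toEnd_gen_e₁ {w : V} (hw : w 0 = 0) : toEnd (gen w) e₁ = w := by
  ext i
  rw [toEnd_apply]
  fin_cases i <;> simp [gen, g2Real, e₁, hw, mul_div_cancel₀]

/-- With D = 0, the [a] blocks contribute only ā × ā = 0 and its conjugate. For unit w, `gen w`
therefore rotates the plane of e₁ and w. -/
theorem toEnd_gen_self {w : V} (hw : w 0 = 0) : toEnd (gen w) w = -(inner ℝ w w • e₁) := by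
  simp only [inner_eq]
  ext i
  rw [toEnd_apply]
  fin_cases i <;> simp [Fin.sum_univ_succ, gen, g2Real, e₁, hw] <;> ring

theorem exists_orbit_eq (p : S6) : ∃ g, orbit g = p := by
  obtain ⟨w, r, hw₀, hw, hr, hp⟩ : ∃ (w : V) (r : ℝ), w 0 = 0 ∧ inner ℝ w w = 1 ∧ 0 ≤ r ∧
      (p : V) = (p : V) 0 • e₁ + r • w := by
    have h₀ : (((p : V) - (p : V) 0 • e₁ : V)) 0 = 0 := by simp [e₁]
    set v : V := (p : V) - (p : V) 0 • e₁ with hv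
    by_cases h : v = 0
    -- Here p is a multiple of e₁, and any unit vector orthogonal to e₁ serves.
    · refine ⟨EuclideanSpace.single 1 1, 0, by simp, by simp, le_rfl, ?_⟩
      rw [zero_smul, add_zero]
      exact sub_eq_zero.1 h
    · have hn : ‖v‖ ≠ 0 := norm_ne_zero_iff.2 h
      refine ⟨‖v‖⁻¹ • v, ‖v‖, by simp [h₀], ?_, norm_nonneg _, ?_⟩
      · rw [inner_smul_left, inner_smul_right, real_inner_self_eq_norm_sq]
        simp
        field_simp
      · rw [smul_smul, mul_inv_cancel₀ hn, one_smul, hv]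
        abel
  have h₁ : (p : V) 0 ^ 2 + r ^ 2 = 1 := by
    have h := inner_coe_self p
    rw [hp, inner_add_left, inner_add_right, inner_add_right] at h
    simp only [inner_smul_left, inner_smul_right, hw, inner_e₁, real_inner_comm e₁ w, hw₀] at h
    simp [e₁] at h
    linarith
  set c := (p : V) 0 with hc
  have hcos : Real.cos (Real.arccos c) = c := Real.cos_arccos (by nlinarith) (by nlinarith)
  have hsin : Real.sin (Real.arccos c) = r := by
    rw [Real.sin_arccos, show 1 - c ^ 2 = r ^ 2 by linarith, Real.sqrt_sq hr]
  -- Now p = cos t · e₁ + sin t · w with t = arccos c, the image of e₁ under rotation by the angle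
  -- t.
  refine ⟨expG2 _ (gen_mem (Real.arccos c • w)), Subtype.ext ?_⟩
  rw [coe_orbit, act]
  change toEnd (NormedSpace.exp (gen (Real.arccos c • w))) e₁ = _
  have he := toEnd_gen_self hw₀
  rw [hw, one_smul] at he
  rw [toEnd_exp, gen_smul, map_smul, exp_apply_of_rotation (toEnd_gen_e₁ hw₀) he, hcos, hsin, ← hp]

/-! ### Tangent vectors of `G₂` -/

theorem contMDiff_orbit_curve {g : G2} (X : Tangent g) :
    ContMDiff 𝓘(ℝ, ℝ) (𝓡 6) ∞ fun t => orbit (X.curve t) := by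
  have := fact_finrank_V
  have h : ContMDiff 𝓘(ℝ, ℝ) 𝓘(ℝ, V) ∞ fun t => (orbit (X.curve t) : V) := by
    refine ContDiff.contMDiff ((contDiff_euclidean).2 fun i => ?_)
    exact X.smooth i 0
  exact h.codRestrict_sphere fun t => (orbit (X.curve t)).2

theorem dincl_dorbit {g : G2} (X : Tangent g) (i : Fin 7) :
    dincl (orbit g) (dorbit X) i = X.velocity i 0 := by
  have hX := contMDiff_orbit_curve X
  -- Substituting the base point removes the transport in `dorbit`.
  obtain ⟨γ, rfl, hγ⟩ := X
  have h := mfderiv_comp (I := 𝓘(ℝ, ℝ)) (I' := 𝓡 6) (I'' := 𝓘(ℝ, V)) (0 : ℝ)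
    (contMDiff_coe.mdifferentiable (by simp) (orbit (γ 0))) (hX.mdifferentiable (by simp) 0)
  have hd : DifferentiableAt ℝ (fun t => (orbit (γ t) : V)) 0 :=
    (differentiableAt_euclidean).2 fun i => ((hγ i 0).differentiable (by simp)) 0
  rw [mfderiv_eq_fderiv] at h
  have h₁ : dincl (orbit (γ 0)) (dorbit ⟨γ, rfl, hγ⟩) = deriv (fun t => (orbit (γ t) : V)) 0 :=
    (congrArg (fun L : ℝ →L[ℝ] V => L 1) h).symm
  rw [h₁]
  have h₂ := ((EuclideanSpace.proj (𝕜 := ℝ) i).hasFDerivAt.comp_hasDerivAt (0 : ℝ)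
    hd.hasDerivAt).deriv
  exact h₂.symm

theorem toEnd_single (A : Matrix (Fin 7) (Fin 7) ℝ) (i j : Fin 7) :
    toEnd A (EuclideanSpace.single j 1) i = A i j := by
  rw [toEnd_apply]
  simp

/-- The curve `t ↦ g exp(t A)` through `g` whose derivative has first column `g w`. -/
noncomputable def genCurve (g : G2) (w : V) (t : ℝ) : G2 := g * expG2 (gen (t • w)) (gen_mem _)

theorem toEnd_mat_genCurve (g : G2) (w : V) (t : ℝ) :
    toEnd (mat (genCurve g w t)) = act g * NormedSpace.exp (t • toEnd (gen w)) := by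
  change toEnd (mat g * NormedSpace.exp (gen (t • w))) = _
  rw [map_mul, toEnd_exp, gen_smul, map_smul]
  rfl

theorem mat_genCurve_apply (g : G2) (w : V) (t : ℝ) (i j : Fin 7) :
    mat (genCurve g w t) i j = EuclideanSpace.proj (𝕜 := ℝ) i
      (act g (NormedSpace.exp (t • toEnd (gen w)) (EuclideanSpace.single j 1))) :=
  (toEnd_single _ i j).symm.trans (congrArg
    (fun L : V →L[ℝ] V => L (EuclideanSpace.single j 1) i) (toEnd_mat_genCurve g w t))

theorem contDiff_exp_smul {E : Type*} [NormedAddCommGroup E] [NormedSpace ℝ E] [CompleteSpace E]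
    (D : E →L[ℝ] E) : ContDiff ℝ ∞ fun t : ℝ => NormedSpace.exp (t • D) := by
  have h : ContDiff ℝ ∞ (NormedSpace.exp : (E →L[ℝ] E) → (E →L[ℝ] E)) :=
    contDiff_iff_contDiffAt.2 fun x => (NormedSpace.exp_analytic (𝕂 := ℝ) x).contDiffAt
  exact h.comp (contDiff_id.smul contDiff_const)

/-- The tangent vector of `genCurve g w`. -/
noncomputable def genTangent (g : G2) (w : V) : Tangent g where
  curve := genCurve g w
  base := by
    apply Subtype.ext
    apply Subtype.ext
    apply toEnd.injective
    refine (toEnd_mat_genCurve g w 0).trans ?_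
    have h : NormedSpace.exp ((0 : ℝ) • toEnd (gen w)) = 1 := by
      rw [← map_smul, ← toEnd_exp, zero_smul, NormedSpace.exp_zero, map_one]
    rw [h, mul_one]
    rfl
  smooth i j := by
    have h : ContDiff ℝ ∞ fun t : ℝ => EuclideanSpace.proj (𝕜 := ℝ) i
        (act g (NormedSpace.exp (t • toEnd (gen w)) (EuclideanSpace.single j 1))) :=
      (EuclideanSpace.proj (𝕜 := ℝ) i).contDiff.comp ((act g).contDiff.comp
        ((contDiff_exp_smul (toEnd (gen w))).clm_apply contDiff_const))
    simp only [mat_genCurve_apply]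
    exact h

theorem dincl_dorbit_genTangent (g : G2) {w : V} (hw : w 0 = 0) :
    dincl (orbit g) (dorbit (genTangent g w)) = act g w := by
  ext i
  rw [dincl_dorbit]
  have h := hasDerivAt_exp_smul_apply (toEnd (gen w)) e₁ 0
  have h₁ := ((EuclideanSpace.proj (𝕜 := ℝ) i).comp (act g)).hasFDerivAt.comp_hasDerivAt (0 : ℝ) h
  have h₂ : NormedSpace.exp ((0 : ℝ) • toEnd (gen w)) = 1 := by
    rw [← map_smul, ← toEnd_exp, zero_smul, NormedSpace.exp_zero, map_one]
  rw [h₂] at h₁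
  have h₃ : toEnd (gen w) ((1 : V →L[ℝ] V) e₁) = w := toEnd_gen_e₁ hw
  rw [h₃] at h₁
  refine Eq.trans ?_ h₁.deriv
  refine congrArg (fun f => deriv f 0) (funext fun t => ?_)
  exact mat_genCurve_apply g w t i 0

theorem act_inv_dincl_zero (g : G2) (u : T (orbit g)) : act g⁻¹ (dincl (orbit g) u) 0 = 0 := by
  rw [← inner_e₁, ← inner_act_act g, act_act_inv, ← coe_orbit, inner_dincl]

/-- Pulling u back by g⁻¹ gives a vector of e₁^⊥, and `gen` realizes each such vector as a velocity.
-/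
theorem exists_dorbit_eq (g : G2) (u : T (orbit g)) : ∃ X : Tangent g, dorbit X = u := by
  refine ⟨genTangent g (act g⁻¹ (dincl (orbit g) u)), dincl_injective _ ?_⟩
  rw [dincl_dorbit_genTangent g (act_inv_dincl_zero g u), act_act_inv]

/-- The complex coordinates on `e₁^⊥ = ℂ³`. -/
noncomputable def zcoord (k : Fin 3) (w : V) : ℂ := ⟨w (![1, 3, 5] k), w (![2, 4, 6] k)⟩

/-- The covector on the sphere that pulls back to `θ^k`. -/
noncomputable def thetaDown (g : G2) (k : Fin 3) (u : T (orbit g)) : ℂ :=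
  Complex.I / 2 * zcoord k (act g⁻¹ (dincl (orbit g) u))

theorem frameInv_mul_mul_frame_apply (B : Matrix (Fin 7) (Fin 7) ℝ) (k : Fin 3) :
    inFrame B (![1, 2, 3] k) 0 = zcoord k (WithLp.toLp 2 fun i => B i 0) := by
  rw [inFrame, frame_inv, Matrix.mul_apply]
  have h : ∀ j, frame j 0 = if j = 0 then 1 else 0 := by
    intro j
    fin_cases j <;> simp [frame]
  simp only [h, mul_ite, mul_one, mul_zero, Finset.sum_ite_eq', Finset.mem_univ, if_true,
    Matrix.mul_apply, Matrix.map_apply]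
  fin_cases k <;> apply Complex.ext <;> simp [frameInv, Fin.sum_univ_succ, zcoord]

theorem theta_eq {g : G2} (k : Fin 3) (X : Tangent g) : theta k X = thetaDown g k (dorbit X) := by
  have h : (WithLp.toLp 2 fun i => ((mat g)⁻¹ * X.velocity) i 0 : V) =
      act g⁻¹ (dincl (orbit g) (dorbit X)) := by
    ext i
    rw [act, toEnd_apply, mat_inv]
    simp only [dincl_dorbit]
    rfl
  rw [theta, maurerCartan, frameInv_mul_mul_frame_apply, h, thetaDown]

end SixSphere

/-! ### The descended coframe and the types of covectors -/

namespace SixSphere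

open ComplexConjugate

/-- `θ^k` as a complex covector on the sphere. -/
noncomputable def thetaCovector (g : G2) (k : Fin 3) : T (orbit g) →L[ℝ] ℂ where
  toFun := thetaDown g k
  map_add' u v := by
    simp only [thetaDown, zcoord, map_add, PiLp.add_apply]
    rw [← mul_add]
    rfl
  map_smul' c u := by
    simp only [thetaDown, zcoord, map_smul, PiLp.smul_apply]
    apply Complex.ext <;> simp <;> ring
  cont := by
    have h : ∀ i, Continuous fun u : T (orbit g) => act g⁻¹ (dincl (orbit g) u) i := fun i =>
      ((EuclideanSpace.proj (𝕜 := ℝ) i).comp ((act g⁻¹).comp (dincl (orbit g)))).continuous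
    exact continuous_const.mul
      (Complex.equivRealProdCLM.symm.continuous.comp ((h _).prodMk (h _)))

theorem act_inv_dincl_octJ (g : G2) (u : T (orbit g)) :
    act g⁻¹ (dincl (orbit g) (octJ (orbit g) u)) =
      cross e₁ (act g⁻¹ (dincl (orbit g) u)) := by
  rw [dincl_octJ, coe_orbit, ← cross_act, act_inv_act]

/-- This is the model case at e₁; equivariance carries it to the type (1,0) of every θ^k. -/
theorem zcoord_cross_e₁ (k : Fin 3) (w : V) : zcoord k (cross e₁ w) = Complex.I * zcoord k w := by
  fin_cases k <;> apply Complex.ext <;> simp [zcoord, cross_apply, crossFun, e₁]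

theorem thetaDown_octJ (g : G2) (k : Fin 3) (u : T (orbit g)) :
    thetaDown g k (octJ (orbit g) u) = Complex.I * thetaDown g k u := by
  rw [thetaDown, act_inv_dincl_octJ, zcoord_cross_e₁, thetaDown]
  ring

theorem eq_of_zcoord_eq {v w : V} (h₀ : v 0 = w 0) (h : ∀ k, zcoord k v = zcoord k w) : v = w := by
  have h' : ∀ k, v (![1, 3, 5] k) = w (![1, 3, 5] k) ∧ v (![2, 4, 6] k) = w (![2, 4, 6] k) :=
    fun k => Complex.ext_iff.1 (h k)
  have h₁ := h' 0
  have h₂ := h' 1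
  have h₃ := h' 2
  ext i
  fin_cases i
  exacts [h₀, h₁.1, h₁.2, h₂.1, h₂.2, h₃.1, h₃.2]

theorem eq_of_thetaDown_eq {g : G2} {u v : T (orbit g)}
    (h : ∀ k, thetaDown g k u = thetaDown g k v) : u = v := by
  apply dincl_injective
  rw [← act_act_inv g (dincl (orbit g) u), ← act_act_inv g (dincl (orbit g) v)]
  congr 1
  refine eq_of_zcoord_eq (by rw [act_inv_dincl_zero, act_inv_dincl_zero]) fun k => ?_
  exact mul_left_cancel₀ (div_ne_zero Complex.I_ne_zero two_ne_zero) (h k)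

/-- The tangent vector at `x(g)` dual to the real coordinate `w i`. -/
noncomputable def frameVec (g : G2) (i : Fin 7) : T (orbit g) :=
  proj (orbit g) (act g (EuclideanSpace.single i 1))

theorem eq_sum_frameVec (g : G2) (u : T (orbit g)) :
    u = ∑ k, (act g⁻¹ (dincl (orbit g) u) (![1, 3, 5] k) • frameVec g (![1, 3, 5] k) +
      act g⁻¹ (dincl (orbit g) u) (![2, 4, 6] k) • frameVec g (![2, 4, 6] k)) := by
  conv_lhs => rw [← proj_dincl (orbit g) u, ← act_act_inv g (dincl (orbit g) u)]
  have h₀ := act_inv_dincl_zero g u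
  generalize act g⁻¹ (dincl (orbit g) u) = w at *
  have hw : w = ∑ k : Fin 3, (w (![1, 3, 5] k) • EuclideanSpace.single (![1, 3, 5] k) 1 +
      w (![2, 4, 6] k) • EuclideanSpace.single (![2, 4, 6] k) 1) := by
    ext i
    fin_cases i <;> simp [Fin.sum_univ_succ, h₀]
  conv_lhs => rw [hw]
  simp only [map_sum, map_add, map_smul]
  rfl

theorem dincl_frameVec (g : G2) {i : Fin 7} (hi : i ≠ 0) :
    dincl (orbit g) (frameVec g i) = act g (EuclideanSpace.single i 1) := by
  apply dincl_proj_of_inner_eq_zero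
  rw [coe_orbit, inner_act_act, inner_e₁]
  simp [hi.symm]

theorem octJ_frameVec (g : G2) (k : Fin 3) :
    octJ (orbit g) (frameVec g (![1, 3, 5] k)) = frameVec g (![2, 4, 6] k) := by
  apply dincl_injective
  have h : cross e₁ (EuclideanSpace.single (![1, 3, 5] k) 1) =
      EuclideanSpace.single (![2, 4, 6] k) 1 := by
    ext i
    fin_cases k <;> fin_cases i <;> simp [cross_apply, crossFun, e₁]
  rw [dincl_octJ, dincl_frameVec g (by fin_cases k <;> simp),
    dincl_frameVec g (by fin_cases k <;> simp), coe_orbit, cross_act, h]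

theorem exists_eq_sum_thetaDown {g : G2} {α : T (orbit g) →L[ℝ] ℂ} (hα : IsType10 octJ (orbit g) α) :
    ∃ c : Fin 3 → ℂ, ∀ u, α u = ∑ k, c k * thetaDown g k u := by
  -- On each J-invariant plane, complex linearity gives α = z_k α(f), f being the first vector of
  -- the plane; the factor −2i inverts the i/2 in θ^k.
  refine ⟨fun k => -2 * Complex.I * α (frameVec g (![1, 3, 5] k)), fun u => ?_⟩
  conv_lhs => rw [eq_sum_frameVec g u]
  rw [map_sum]
  refine Finset.sum_congr rfl fun k _ => ?_
  rw [map_add, map_smul, map_smul, ← octJ_frameVec, hα, thetaDown, zcoord]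
  apply Complex.ext <;> simp <;> ring

theorem conj_I_div_two : conj (Complex.I / 2) = -Complex.I / 2 := by
  rw [map_div₀, Complex.conj_I, Complex.conj_ofNat]

theorem exists_eq_sum_conj_thetaDown {g : G2} {α : T (orbit g) →L[ℝ] ℂ}
    (hα : IsType01 octJ (orbit g) α) :
    ∃ c : Fin 3 → ℂ, ∀ u, α u = ∑ k, c k * conj (thetaDown g k u) := by
  refine ⟨fun k => 2 * Complex.I * α (frameVec g (![1, 3, 5] k)), fun u => ?_⟩
  conv_lhs => rw [eq_sum_frameVec g u]
  rw [map_sum]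
  refine Finset.sum_congr rfl fun k _ => ?_
  rw [map_add, map_smul, map_smul, ← octJ_frameVec, hα, thetaDown, map_mul, conj_I_div_two,
    zcoord]
  apply Complex.ext <;> simp <;> ring

theorem isOctonionic_octJ : IsOctonionic octJ := by
  intro g α
  constructor
  · constructor
    · intro hα
      obtain ⟨c, hc⟩ := exists_eq_sum_thetaDown hα
      exact ⟨c, fun X => by simp only [hc, theta_eq]⟩
    · rintro ⟨c, hc⟩ u
      obtain ⟨X, rfl⟩ := exists_dorbit_eq g u
      -- The hypothesis only evaluates α on images of dx, so Ju is lifted as well.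
      obtain ⟨Y, hY⟩ := exists_dorbit_eq g (octJ (orbit g) (dorbit X))
      rw [← hY, hc, hc, Finset.mul_sum]
      refine Finset.sum_congr rfl fun k _ => ?_
      rw [theta_eq, theta_eq, hY, thetaDown_octJ]
      ring
  · constructor
    · intro hα
      obtain ⟨c, hc⟩ := exists_eq_sum_conj_thetaDown hα
      exact ⟨c, fun X => by simp only [hc, theta_eq]⟩
    · rintro ⟨c, hc⟩ u
      obtain ⟨X, rfl⟩ := exists_dorbit_eq g u
      obtain ⟨Y, hY⟩ := exists_dorbit_eq g (octJ (orbit g) (dorbit X))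
      rw [← hY, hc, hc, Finset.mul_sum]
      refine Finset.sum_congr rfl fun k _ => ?_
      rw [theta_eq, theta_eq, hY, thetaDown_octJ, map_mul, Complex.conj_I]
      ring

theorem isType10_thetaCovector (g : G2) (k : Fin 3) :
    IsType10 octJ (orbit g) (thetaCovector g k) := thetaDown_octJ g k

/-- Both structures give θ^k ∘ J = iθ^k, and the θ^k separate tangent vectors. -/
theorem eq_octJ_of_isOctonionic {J' : ∀ p : S6, T p →L[ℝ] T p} (h : IsOctonionic J') :
    J' = octJ := by
  funext p
  obtain ⟨g, rfl⟩ := exists_orbit_eq p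
  ext1 u
  refine eq_of_thetaDown_eq fun k => ?_
  have h₁ := (h g (thetaCovector g k)).1.2
    ((isOctonionic_octJ g (thetaCovector g k)).1.1 (isType10_thetaCovector g k)) u
  rw [thetaDown_octJ]
  exact h₁

/-! ### The metric, ω and Υ in the coframe -/

theorem gcan_eq_thetaDown (g : G2) (u v : T (orbit g)) : (gcan (orbit g) u v : ℂ) =
    4 * ∑ k, (thetaDown g k u * conj (thetaDown g k v) +
      thetaDown g k v * conj (thetaDown g k u)) / 2 := by
  rw [gcan, ← inner_act_act g⁻¹]
  have hu := act_inv_dincl_zero g u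
  have hv := act_inv_dincl_zero g v
  simp only [thetaDown, map_mul, conj_I_div_two]
  generalize act g⁻¹ (dincl (orbit g) u) = a at *
  generalize act g⁻¹ (dincl (orbit g) v) = b at *
  rw [inner_eq, Fin.sum_univ_three]
  apply Complex.ext <;> simp [zcoord, hu, hv] <;> ring

theorem omega_eq_thetaDown (g : G2) (u v : T (orbit g)) :
    (octHermitian.omega (orbit g) ![u, v] : ℂ) = 2 * Complex.I *
      ∑ k, (thetaDown g k u * conj (thetaDown g k v) -
        thetaDown g k v * conj (thetaDown g k u)) := by
  have h : octHermitian.omega (orbit g) ![u, v] =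
      inner ℝ (dincl (orbit g) (octJ (orbit g) u)) (dincl (orbit g) v) := rfl
  rw [h, ← inner_act_act g⁻¹, act_inv_dincl_octJ]
  have hu := act_inv_dincl_zero g u
  have hv := act_inv_dincl_zero g v
  simp only [thetaDown, map_mul, conj_I_div_two]
  generalize act g⁻¹ (dincl (orbit g) u) = a at *
  generalize act g⁻¹ (dincl (orbit g) v) = b at *
  rw [inner_eq, Fin.sum_univ_three]
  apply Complex.ext <;> simp [zcoord, hu, hv, cross_apply, crossFun, e₁] <;> ring

theorem ambientUpsilon_act (g : G2) (x : V) (v : Fin 3 → V) :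
    ambientUpsilon (act g x) (fun i => act g (v i)) = ambientUpsilon x v := by
  simp only [ambientUpsilon_apply, chiFun, cross_act, inner_act_act]

/-- Since 8(i/2)³ = −i, the form at e₁ is −i dz¹ ∧ dz² ∧ dz³ on ℂ³, and φ restricts there to the
real part of dz¹ ∧ dz² ∧ dz³. -/
theorem ambientUpsilon_e₁ {v : Fin 3 → V} (hv : ∀ i, v i 0 = 0) : ambientUpsilon e₁ v =
    8 * Matrix.det (Matrix.of fun i j => Complex.I / 2 * zcoord i (v j)) := by
  rw [ambientUpsilon_apply, chiFun, Matrix.det_fin_three]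
  simp only [hv, inner_eq, Matrix.of_apply]
  apply Complex.ext <;> simp [zcoord, hv, cross_apply, crossFun, e₁] <;> ring

/-- The `(3,0)`-form on the sphere. -/
noncomputable def upsilon : ∀ p : S6, T p [⋀^Fin 3]→L[ℝ] ℂ := restrictForm ambientUpsilon

theorem upsilon_eq_thetaDown (g : G2) (v : Fin 3 → T (orbit g)) :
    upsilon (orbit g) v = 8 * Matrix.det (Matrix.of fun i j => thetaDown g i (v j)) := by
  have h : upsilon (orbit g) v = ambientUpsilon (act g e₁)
      (fun i => act g (act g⁻¹ (dincl (orbit g) (v i)))) := by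
    simp only [act_act_inv, ← coe_orbit]
    rfl
  rw [h, ambientUpsilon_act, ambientUpsilon_e₁ fun i => act_inv_dincl_zero g (v i)]
  rfl

theorem isType30_upsilon : IsType30 octJ upsilon := by
  intro p
  obtain ⟨g, rfl⟩ := exists_orbit_eq p
  have h : (fun v => upsilon (orbit g) v) = (8 : ℂ) • fun v : Fin 3 → T (orbit g) =>
      Matrix.det (Matrix.of fun i j => thetaCovector g i (v j)) :=
    funext fun v => upsilon_eq_thetaDown g v
  rw [h]
  exact Submodule.smul_mem _ _ (Submodule.subset_span
    ⟨thetaCovector g, isType10_thetaCovector g, rfl⟩)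

theorem d_omega (p : S6) (v : Fin 3 → T p) :
    ManifoldForm.d (𝓡 6) octHermitian.omega p v = -3 * (upsilon p v).im := by
  rw [octHermitian_omega, d_restrictForm p ambientOmega.differentiableAt, extDeriv_ambientOmega]
  have h : upsilon p v = ambientUpsilon p fun i => dincl p (v i) := rfl
  rw [h, ambientUpsilon_apply]
  have h' : ((3 : ℝ) • assocForm) (fun i => dincl p (v i)) =
    3 * inner ℝ (cross (dincl p (v 0)) (dincl p (v 1))) (dincl p (v 2)) := rfl
  rw [h']
  simp

end SixSphere

open ComplexConjugate in
theorem mainTheorem3 :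
    ∃ h : AlmostHermitian,
      -- `h.J` is the (unique) octonionic almost complex structure `J_can`
      IsOctonionic h.J ∧ (∀ J' : ∀ p : S6, T p →L[ℝ] T p, IsOctonionic J' → J' = h.J) ∧
      h.IsNearlyKahler ∧
      -- `x^* g_can = 4 θᵗ ∘ θ̄`
      (∀ (g : G2) (X Y : Tangent g),
        (gcan (orbit g) (dorbit X) (dorbit Y) : ℂ) =
          4 * ∑ k, (theta k X * conj (theta k Y) + theta k Y * conj (theta k X)) / 2) ∧
      -- `x^* ω = 2 i θᵗ ∧ θ̄`
      (∀ (g : G2) (X Y : Tangent g),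
        (h.omega (orbit g) ![dorbit X, dorbit Y] : ℂ) =
          2 * Complex.I *
            ∑ k, (theta k X * conj (theta k Y) - theta k Y * conj (theta k X))) ∧
      ManifoldForm.IsSmooth (𝓡 6) h.omega ∧
      ∃ Υ : ∀ p : S6, T p [⋀^Fin 3]→L[ℝ] ℂ,
        ManifoldForm.IsSmooth (𝓡 6) Υ ∧
        IsType30 h.J Υ ∧
        -- `x^* Υ = 8 θ¹ ∧ θ² ∧ θ³`
        (∀ (g : G2) (X : Fin 3 → Tangent g),
          Υ (orbit g) (fun j => dorbit (X j)) =
            8 * Matrix.det (Matrix.of fun i j => theta i (X j))) ∧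
        -- `dω = -3 Im Υ`
        (∀ (p : S6) (v : Fin 3 → T p),
          ManifoldForm.d (𝓡 6) h.omega p v = -3 * (Υ p v).im) := by
  refine ⟨octHermitian, isOctonionic_octJ, fun J' => eq_octJ_of_isOctonionic,
    octHermitian_isNearlyKahler, fun g X Y => ?_, fun g X Y => ?_, ?_, upsilon,
    isSmooth_restrictForm contDiff_ambientUpsilon, isType30_upsilon, fun g X => ?_, d_omega⟩
  · simp only [theta_eq]
    exact gcan_eq_thetaDown g _ _
  · simp only [theta_eq]
    exact omega_eq_thetaDown g _ _
  · rw [octHermitian_omega]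
    exact isSmooth_restrictForm ambientOmega.contDiff
  · simp only [theta_eq]
    exact upsilon_eq_thetaDown g _
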